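/- Let $X$ be a metric space with its Borel $\sigma$-algebra, let $\sigma$ be a finite non-zero measure on $X$ with $\sigma(\{x\})=0$ for all $x\in X$, let $\Omega$ be the set of Radon measures on $X$ of the form $\omega=\sum_{i=1}^N\delta_{x_i}$ with $N\in\mathbb N\cup\{\infty\}$ and pairwise distinct $x_i\in X$ (identified with the sets $\{x_i\}$), equipped with the $\sigma$-algebra generated by the maps $\omega\mapsto\omega(B)$, $B\subset X$ Borel, and let $\pi$ be the Poisson measure on $\Omega$ with intensity $\sigma$, i.e. for all disjoint Borel sets $A_1,\dots,A_n$ and all $k_1,\dots,k_n\in\mathbb N$, $$\pi(\omega(A_1)=k_1,\dots,\omega(A_n)=k_n)=\prod_{i=1}^n\frac{\sigma(A_i)^{k_i}}{k_i!}e^{-\sigma(A_i)}.$$ For $F:\Omega\to\mathbb R$ let $D_xF(\omega)=F(\omega)-F(\omega+\delta_x)$ if $x\notin\omega$ and $D_xF(\omega)=F(\omega)-F(\omega-\delta_x)$ if $x\in\omega$, and let $|DF(\omega)|_{\infty}=|DF(\omega)|_{L^\infty(\frac{\sigma+\omega}{2})}$ be the essential supremum of $x\mapsto|D_xF(\omega)|$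 with respect to $\frac{\sigma+\omega}{2}$. Let $$\lambda_\infty=\inf_F\frac{E[|DF|_\infty^2]}{\operatorname{Var}(F)},\qquad h_\infty=\inf_{0<\pi(A)<\frac12}\frac{E[|D1_A|_\infty]}{\pi(A)},$$ where $F$ runs over the measurable square-integrable functions on $\Omega$ that are not almost surely constant, $A$ runs over the measurable subsets of $\Omega$, and $E$ and $\operatorname{Var}$ are taken under $\pi$. (Here $|D1_A|_\infty$ is the indicator function of the boundary $\partial A$ of $A$, the set of those $\omega\in A$ that have a neighbour $\omega-\delta_x\notin A$, $x\in\omega$, or a $\sigma$-non-negligible set of $x$ with $\omega+\delta_x\notin A$, together with those $\omega\notin A$ for which the same holds with $A$ and its complement exchanged; thus $h_\infty=\inf_{0<\pi(A)<1/2}\pi(\partial A)/\pi(A)$.) Then $$\lambda_\infty=\frac{1}{\sigma(X)}\ \ge\ \frac{(\sqrt{h_\infty+1}-1)^2}{4}.$$ -/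

import Mathlib

open MeasureTheory ProbabilityTheory
open scoped ENNReal

/-- A configuration of points of `X`: the support of a Radon measure `∑ i, δ_{x_i}`, where the
(finitely or countably many) points `x_i` are pairwise distinct. -/
@[ext]
structure Configuration (X : Type*) [TopologicalSpace X] where
  carrier : Set X
  countable : carrier.Countable
  finite_inter : ∀ K : Set X, IsCompact K → (carrier ∩ K).Finite

namespace Configuration

variable {X : Type*} [TopologicalSpace X]

/-- `ω + δ_x` (for `x ∉ ω`), i.e. `ω ∪ {x}`. -/
def addPoint (ω : Configuration X) (x : X) : Configuration X where
  carrier := insert x ω.carrier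
  countable := ω.countable.insert x
  finite_inter K hK := ((ω.finite_inter K hK).insert x).subset (by
    rintro y ⟨rfl | hy, hyK⟩
    · exact Set.mem_insert _ _
    · exact Set.mem_insert_of_mem _ ⟨hy, hyK⟩)

/-- `ω - δ_x` (for `x ∈ ω`), i.e. `ω \ {x}`. -/
def removePoint (ω : Configuration X) (x : X) : Configuration X where
  carrier := ω.carrier \ {x}
  countable := ω.countable.mono Set.sdiff_subset
  finite_inter K hK := (ω.finite_inter K hK).subset
    (Set.inter_subset_inter_left K Set.sdiff_subset)

/-- `ω(B)`, the number of points of `ω` in `B`. -/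
noncomputable def number (ω : Configuration X) (B : Set X) : ℕ∞ := (ω.carrier ∩ B).encard

/-- The σ-algebra on configurations generated by the maps `ω ↦ ω(B)`, `B` measurable. -/
noncomputable instance instMeasurableSpace [MeasurableSpace X] : MeasurableSpace (Configuration X) :=
  ⨆ (B : Set X) (_ : MeasurableSet B), MeasurableSpace.comap (fun ω => number ω B) ⊤

/-- The configuration `ω` regarded as the measure `∑_{x ∈ ω} δ_x` on `X`. -/
noncomputable def toMeasure [MeasurableSpace X] (ω : Configuration X) : Measure X :=
  Measure.sum fun x : ω.carrier => Measure.dirac (x : X)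

open Classical in
/-- The finite difference gradient: `D_x F(ω) = F(ω) - F(ω + δ_x)` if `x ∉ ω`, and
`D_x F(ω) = F(ω) - F(ω - δ_x)` if `x ∈ ω`. -/
noncomputable def grad (F : Configuration X → ℝ) (ω : Configuration X) (x : X) : ℝ :=
  if x ∈ ω.carrier then F ω - F (ω.removePoint x) else F ω - F (ω.addPoint x)

variable [MeasurableSpace X]

/-- `|DF(ω)|_{L^p((σ + ω)/2)}`. -/
noncomputable def gradNorm (σ : Measure X) (p : ℝ≥0∞) (F : Configuration X → ℝ)
    (ω : Configuration X) : ℝ≥0∞ :=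
  eLpNorm (grad F ω) p ((2⁻¹ : ℝ≥0∞) • (σ + ω.toMeasure))

/-- `π` is the Poisson measure with intensity `σ`: the numbers of points in disjoint measurable
sets `A_1, …, A_n` are independent Poisson variables with parameters `σ(A_1), …, σ(A_n)`. -/
def IsPoissonMeasure (σ : Measure X) (π : Measure (Configuration X)) : Prop :=
  ∀ (n : ℕ) (A : Fin n → Set X), (∀ i, MeasurableSet (A i)) →
    Pairwise (fun i j => Disjoint (A i) (A j)) → ∀ k : Fin n → ℕ,
      π {ω | ∀ i, ω.number (A i) = k i} =
        ENNReal.ofReal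
          (∏ i, σ.real (A i) ^ k i / (k i).factorial * Real.exp (-σ.real (A i)))

/-- The two-sided isoperimetric constant `h_p`: the infimum over the measurable sets `A` with
`0 < π(A) < 1/2` of `E[|D 1_A|_{L^p((σ + ω)/2)}] / π(A)`. For `p = ∞` the numerator is the
`π`-measure of the boundary of `A`. -/
noncomputable def isoperimetricConstant (σ : Measure X) (π : Measure (Configuration X))
    (p : ℝ≥0∞) : ℝ≥0∞ :=
  ⨅ (A : Set (Configuration X)) (_ : MeasurableSet A) (_ : 0 < π A) (_ : π A < 1 / 2),
    (∫⁻ ω, gradNorm σ p (A.indicator fun _ => 1) ω ∂π) / π A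

/-- The Poincaré constant `λ_p`: the infimum over the square-integrable functions `F` that are
not almost surely constant of `E[|DF|_{L^p((σ + ω)/2)}^2] / Var(F)`. -/
noncomputable def poincareConstant (σ : Measure X) (π : Measure (Configuration X))
    (p : ℝ≥0∞) : ℝ≥0∞ :=
  ⨅ (F : Configuration X → ℝ) (_ : Measurable F) (_ : MemLp F 2 π) (_ : evariance F π ≠ 0),
    (∫⁻ ω, gradNorm σ p F ω ^ 2 ∂π) / evariance F π

end Configuration

/-!
Let `N ω = ω(X)`. Almost surely `ω` is finite, and its count vector `(ω(B))_B` is a compound Poisson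
variable: it is distributed as the sum of a Poisson number, of mean `σ(X)`, of independent vectors
`(δ_x(B))_B` with `x` of law `σ / σ(X)` (compare characteristic functions). Cutting the sum into
`n` independent pieces and bounding the variance piece by piece by the mean squared increment, up
to an error of order `1 / n`, gives the Poincaré inequality `Var F ≤ E ∫ |D_x F|² σ(dx)`; here
`D_x F(ω) = F(ω) - F(ω + δ_x)` for `σ`-almost every `x`, since `ω` is `σ`-null. The right-hand side
is at most `σ(X) E |DF|²_∞`, and for `F = N` there is equality, since `|DN|_∞ = 1` and
`Var N = σ(X)`.

For the isoperimetric inequality write `h` for `h_∞` and let `m` be a median of `N`. The level sets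
`{D > j}` of `D = (N - m)⁺` and `D = (N - m)⁻` have measure at most `1 / 2`, and their boundaries
are contained in `{D = j} ∪ {D = j + 1}`. Weighting `h π(D > j) ≤ π(D = j) + π(D = j + 1)` with
`2 j + 1` and summing over `j` gives `h E D² ≤ 4 E D + π(D = 0)`. Hence `s² = E |N - m|²`, which is
at least `Var N = σ(X)`, satisfies `h s² ≤ 4 s + 2`, so that `(h + 1) s² ≤ (s + 2)²`.
-/

section Variance

variable {Ω : Type*} [MeasurableSpace Ω] {μ : Measure Ω} {Y : Ω → ℝ}

theorem memLp_of_forall_norm_le [IsFiniteMeasure μ] {p : ℝ≥0∞} {C : ℝ} (hY : Measurable Y)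
    (hC : ∀ ω, ‖Y ω‖ ≤ C) : MemLp Y p μ :=
  .of_bound hY.aestronglyMeasurable C (.of_forall hC)

theorem evariance_map {Ω' : Type*} [MeasurableSpace Ω'] {f : Ω → Ω'} {Z : Ω' → ℝ}
    (hZ : Measurable Z) (hf : Measurable f) :
    evariance Z (μ.map f) = evariance (Z ∘ f) μ := by
  rw [evariance, evariance, lintegral_map (by fun_prop) hf,
    integral_map hf.aemeasurable hZ.aestronglyMeasurable]
  rfl

variable [IsProbabilityMeasure μ]

theorem lintegral_enorm_sub_sq (hY : MemLp Y 2 μ) (c : ℝ) :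
    ∫⁻ ω, ‖Y ω - c‖ₑ ^ 2 ∂μ = evariance Y μ + ‖μ[Y] - c‖ₑ ^ 2 := by
  have hYc : MemLp (fun ω => Y ω - c) 2 μ := hY.sub (memLp_const c)
  have hvar : Var[fun ω => Y ω - c; μ] = μ[fun ω => (Y ω - c) ^ 2] - (μ[Y] - c) ^ 2 := by
    have hmean : μ[fun ω => Y ω - c] = μ[Y] - c := by
      rw [integral_sub (hY.integrable one_le_two) (integrable_const c)]
      simp
    rw [variance_eq_sub hYc, hmean]
    rfl
  rw [variance_sub_const hY.aestronglyMeasurable] at hvar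
  have hsq (y : ℝ) : ‖y‖ₑ ^ 2 = ENNReal.ofReal (y ^ 2) := by
    rw [Real.enorm_eq_ofReal_abs, ← ENNReal.ofReal_pow (abs_nonneg y), sq_abs]
  simp_rw [hsq]
  rw [← ofReal_integral_eq_lintegral_ofReal hYc.integrable_sq
      (.of_forall fun ω => sq_nonneg _), ← ofReal_variance hY,
    ← ENNReal.ofReal_add (variance_nonneg Y μ) (sq_nonneg _), hvar, sub_add_cancel]

theorem evariance_le_lintegral_enorm_sub_sq (hY : MemLp Y 2 μ) (c : ℝ) :
    evariance Y μ ≤ ∫⁻ ω, ‖Y ω - c‖ₑ ^ 2 ∂μ :=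
  (lintegral_enorm_sub_sq hY c).symm ▸ le_self_add

theorem enorm_integral_sq_le_lintegral (hY : MemLp Y 2 μ) :
    ‖μ[Y]‖ₑ ^ 2 ≤ ∫⁻ ω, ‖Y ω‖ₑ ^ 2 ∂μ := by
  have h := lintegral_enorm_sub_sq hY 0
  simp only [sub_zero] at h
  exact h ▸ le_add_self

end Variance

section Clamp

/-- The projection of a real number onto `[-n, n]`, used to truncate functions. -/
noncomputable def clamp (n : ℕ) (y : ℝ) : ℝ :=
  Set.projIcc (-n : ℝ) n (neg_le_self n.cast_nonneg) y

theorem continuous_clamp (n : ℕ) : Continuous (clamp n) :=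
  continuous_subtype_val.comp continuous_projIcc

theorem norm_clamp_le (n : ℕ) (y : ℝ) : ‖clamp n y‖ ≤ n :=
  abs_le.2 (Set.projIcc (-n : ℝ) n (neg_le_self n.cast_nonneg) y).2

theorem norm_clamp_sub_clamp_le (n : ℕ) (y z : ℝ) : ‖clamp n y - clamp n z‖ ≤ ‖y - z‖ :=
  Set.abs_projIcc_sub_projIcc _

theorem norm_clamp_le_norm (n : ℕ) (y : ℝ) : ‖clamp n y‖ ≤ ‖y‖ := by
  have hzero : clamp n 0 = 0 := by
    rw [clamp, Set.projIcc_of_mem _ (by simp)]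
  simpa [hzero] using norm_clamp_sub_clamp_le n y 0

theorem tendsto_clamp (y : ℝ) : Filter.Tendsto (fun n => clamp n y) Filter.atTop (nhds y) := by
  refine tendsto_const_nhds.congr' ?_
  filter_upwards [Filter.eventually_ge_atTop ⌈|y|⌉₊] with n hn
  rw [clamp, Set.projIcc_of_mem _ (abs_le.1 (Nat.ceil_le.1 hn))]

theorem evariance_le_of_forall_clamp_le {Ω : Type*} [MeasurableSpace Ω] {μ : Measure Ω}
    {Y : Ω → ℝ} {B : ℝ≥0∞} (hY : Integrable Y μ)
    (hB : ∀ n, evariance (fun ω => clamp n (Y ω)) μ ≤ B) : evariance Y μ ≤ B := by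
  have hmeas (n : ℕ) : AEStronglyMeasurable (fun ω => clamp n (Y ω)) μ :=
    (continuous_clamp n).comp_aestronglyMeasurable hY.1
  have hmean : Filter.Tendsto (fun n => ∫ ω, clamp n (Y ω) ∂μ) Filter.atTop (nhds μ[Y]) :=
    tendsto_integral_of_dominated_convergence _ hmeas hY.norm
      (fun n => .of_forall fun ω => norm_clamp_le_norm n (Y ω))
      (.of_forall fun ω => tendsto_clamp (Y ω))
  have hsq (ω : Ω) : Filter.Tendsto
      (fun n => ‖clamp n (Y ω) - ∫ ω, clamp n (Y ω) ∂μ‖ₑ ^ 2) Filter.atTop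
      (nhds (‖Y ω - μ[Y]‖ₑ ^ 2)) :=
    ((ENNReal.continuous_pow 2).tendsto _).comp ((tendsto_clamp (Y ω)).sub hmean).enorm
  calc evariance Y μ
      = ∫⁻ ω, Filter.liminf (fun n => ‖clamp n (Y ω) - ∫ ω, clamp n (Y ω) ∂μ‖ₑ ^ 2)
          Filter.atTop ∂μ := lintegral_congr fun ω => (hsq ω).liminf_eq.symm
    _ ≤ Filter.liminf (fun n => evariance (fun ω => clamp n (Y ω)) μ) Filter.atTop :=
        lintegral_liminf_le' fun n => ((hmeas n).sub aestronglyMeasurable_const).enorm.pow_const 2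
    _ ≤ B := (Filter.liminf_le_liminf (.of_forall hB)).trans_eq (Filter.liminf_const B)

end Clamp

section Convolution

variable {V : Type*} [MeasurableSpace V] [AddCommMonoid V] [MeasurableAdd₂ V]
  {P Q : Measure V} {F : V → ℝ} {C : ℝ}

theorem measurable_integral_translate [SFinite Q] (hF : Measurable F) :
    Measurable fun v => ∫ w, F (v + w) ∂Q :=
  ((hF.comp measurable_add).stronglyMeasurable.integral_prod_right').measurable

/-- The mean squared increment `E‖F(v + W) - F(v)‖²` at `v`, where `W` has law `Q`. -/
noncomputable def meanSqIncrement (Q : Measure V) (F : V → ℝ) (v : V) : ℝ≥0∞ :=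
  ∫⁻ w, ‖F (v + w) - F v‖ₑ ^ 2 ∂Q

theorem measurable_meanSqIncrement [SFinite Q] (hF : Measurable F) :
    Measurable (meanSqIncrement Q F) :=
  Measurable.lintegral_prod_right (f := fun v w => ‖F (v + w) - F v‖ₑ ^ 2)
    (((hF.comp measurable_add).sub (hF.comp measurable_fst)).enorm.pow_const 2)

variable [IsProbabilityMeasure Q]

theorem evariance_conv_le [IsFiniteMeasure P] (hF : Measurable F) (hC : ∀ v, ‖F v‖ ≤ C) :
    evariance F (P ∗ Q) ≤
      evariance (fun v => ∫ w, F (v + w) ∂Q) P + ∫⁻ v, meanSqIncrement Q F v ∂P := by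
  set g : V → ℝ := fun v => ∫ w, F (v + w) ∂Q
  have hmean : (P ∗ Q)[F] = P[g] :=
    integral_conv ((memLp_of_forall_norm_le hF hC).integrable one_le_two)
  have hsection (v : V) : MemLp (fun w => F (v + w)) 2 Q :=
    memLp_of_forall_norm_le (hF.comp (measurable_const_add v)) fun w => hC (v + w)
  calc evariance F (P ∗ Q)
      = ∫⁻ v, ∫⁻ w, ‖F (v + w) - P[g]‖ₑ ^ 2 ∂Q ∂P := by
        rw [evariance, hmean, Measure.lintegral_conv ((hF.sub_const _).enorm.pow_const 2)]
    _ = ∫⁻ v, (‖g v - P[g]‖ₑ ^ 2 + evariance (fun w => F (v + w)) Q) ∂P :=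
        lintegral_congr fun v => by rw [lintegral_enorm_sub_sq (hsection v), add_comm]
    _ ≤ ∫⁻ v, (‖g v - P[g]‖ₑ ^ 2 + meanSqIncrement Q F v) ∂P :=
        lintegral_mono fun v => by
          gcongr
          exact evariance_le_lintegral_enorm_sub_sq (hsection v) (F v)
    _ = evariance g P + ∫⁻ v, meanSqIncrement Q F v ∂P :=
        lintegral_add_left
          (((measurable_integral_translate hF).sub_const _).enorm.pow_const 2) _

theorem lintegral_meanSqIncrement_integral_translate_le (hF : Measurable F)
    (hC : ∀ v, ‖F v‖ ≤ C) :
    ∫⁻ v, meanSqIncrement Q (fun v => ∫ w, F (v + w) ∂Q) v ∂P ≤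
      ∫⁻ v, meanSqIncrement Q F v ∂(P ∗ Q) := by
  have hL2 (v : V) : MemLp (fun w => F (v + w)) 2 Q :=
    memLp_of_forall_norm_le (hF.comp (measurable_const_add v)) fun w => hC (v + w)
  have hjensen (v w : V) : ‖∫ u, F (v + w + u) ∂Q - ∫ u, F (v + u) ∂Q‖ₑ ^ 2 ≤
      ∫⁻ u, ‖F (v + u + w) - F (v + u)‖ₑ ^ 2 ∂Q := by
    rw [← integral_sub ((hL2 (v + w)).integrable one_le_two) ((hL2 v).integrable one_le_two)]
    simp only [add_right_comm v w]
    exact enorm_integral_sq_le_lintegral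
      (((hL2 (v + w)).sub (hL2 v)).ae_eq (.of_forall fun u => by simp [add_right_comm]))
  calc ∫⁻ v, meanSqIncrement Q (fun v => ∫ w, F (v + w) ∂Q) v ∂P
      ≤ ∫⁻ v, ∫⁻ w, ∫⁻ u, ‖F (v + u + w) - F (v + u)‖ₑ ^ 2 ∂Q ∂Q ∂P :=
        lintegral_mono fun v => lintegral_mono fun w => hjensen v w
    _ = ∫⁻ v, ∫⁻ u, meanSqIncrement Q F (v + u) ∂Q ∂P :=
        lintegral_congr fun v => lintegral_lintegral_swap <|
          (((hF.comp (by fun_prop)).sub (hF.comp (by fun_prop))).enorm.pow_const 2).aemeasurable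
    _ = ∫⁻ v, meanSqIncrement Q F v ∂(P ∗ Q) :=
        (Measure.lintegral_conv (measurable_meanSqIncrement hF)).symm

end Convolution

section PoissonMeasure

open scoped NNReal

theorem poissonMeasure_zero : poissonMeasure 0 = Measure.dirac 0 := by
  refine Measure.ext_of_singleton fun n => ?_
  rw [poissonMeasure_singleton]
  rcases n.eq_zero_or_pos with rfl | hn
  · simp
  · simp [hn.ne, hn.ne']

theorem poissonMeasure_singleton_one_le (r : ℝ≥0) : poissonMeasure r {1} ≤ r := by
  rw [poissonMeasure_singleton, ← ENNReal.ofReal_coe_nnreal]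
  refine ENNReal.ofReal_le_ofReal ?_
  simpa using mul_le_of_le_one_left r.coe_nonneg (Real.exp_le_one_iff.2 (neg_nonpos.2 r.coe_nonneg))

theorem poissonMeasure_Ici_two_le (r : ℝ≥0) : poissonMeasure r (Set.Ici 2) ≤ r ^ 2 := by
  have hIci : (Set.Ici 2 : Set ℕ) = {0, 1}ᶜ := by
    ext n
    simp only [Set.mem_Ici, Set.mem_compl_iff, Set.mem_insert_iff, Set.mem_singleton_iff]
    lia
  have hpair : (poissonMeasure r).real {0, 1} = Real.exp (-r) * (1 + r) := by
    rw [Set.insert_eq, measureReal_union (by simp) (measurableSet_singleton 1),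
      poissonMeasure_real_singleton, poissonMeasure_real_singleton]
    simp [mul_add]
  have hexp : 1 - (r : ℝ) ≤ Real.exp (-r) := by linarith [Real.add_one_le_exp (-(r : ℝ))]
  have hreal : (poissonMeasure r).real (Set.Ici 2) ≤ (r : ℝ) ^ 2 := by
    rw [hIci, probReal_compl_eq_one_sub .of_discrete, hpair]
    nlinarith [r.coe_nonneg, mul_le_mul_of_nonneg_right hexp (add_nonneg zero_le_one r.coe_nonneg)]
  rw [← ofReal_measureReal, ← ENNReal.ofReal_coe_nnreal, ← ENNReal.ofReal_pow r.coe_nonneg]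
  exact ENNReal.ofReal_le_ofReal hreal

theorem hasSum_poisson_mul {r : ℝ≥0} {g : ℕ → ℝ} {S : ℝ}
    (h : HasSum (fun n : ℕ => Real.exp (-r) * r ^ n / n.factorial * g (n + 1)) S) :
    HasSum (fun n : ℕ => Real.exp (-r) * r ^ n / n.factorial * (n * g n)) (r * S) := by
  refine (hasSum_nat_add_iff' 1).1 ?_
  convert! h.mul_left (r : ℝ) using 1
  · ext n
    have := n.factorial_pos
    rw [Nat.factorial_succ]
    push_cast
    field_simp
    ring
  · simp

theorem hasSum_poisson_id (r : ℝ≥0) :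
    HasSum (fun n : ℕ => Real.exp (-r) * r ^ n / n.factorial * n) r := by
  simpa using hasSum_poisson_mul (g := 1) (S := 1) (by simpa using hasSum_one_poissonMeasure r)

theorem hasSum_poisson_sq (r : ℝ≥0) :
    HasSum (fun n : ℕ => Real.exp (-r) * r ^ n / n.factorial * (n : ℝ) ^ 2) (r * (r + 1)) := by
  have hsucc : HasSum
      (fun n : ℕ => Real.exp (-r) * r ^ n / n.factorial * ((n + 1 : ℕ) : ℝ)) (r + 1) := by
    simpa [mul_add] using (hasSum_poisson_id r).add (hasSum_one_poissonMeasure r)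
  simpa [sq] using hasSum_poisson_mul (g := fun n => n) hsucc

theorem memLp_natCast_poissonMeasure (r : ℝ≥0) :
    MemLp (fun n : ℕ => (n : ℝ)) 2 (poissonMeasure r) := by
  rw [memLp_two_iff_integrable_sq Measurable.of_discrete.aestronglyMeasurable,
    integrable_poissonMeasure_iff]
  simpa using (hasSum_poisson_sq r).summable

theorem evariance_natCast_poissonMeasure (r : ℝ≥0) :
    evariance (fun n : ℕ => (n : ℝ)) (poissonMeasure r) = r := by
  have hL2 := memLp_natCast_poissonMeasure r
  rw [← hL2.ofReal_variance_eq, variance_eq_sub hL2, integral_poissonMeasure,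
    integral_poissonMeasure]
  simp only [smul_eq_mul, Pi.pow_apply]
  rw [(hasSum_poisson_sq r).tsum_eq, (hasSum_poisson_id r).tsum_eq, mul_add, ← sq, mul_one,
    add_sub_cancel_left, ENNReal.ofReal_coe_nnreal]

end PoissonMeasure

section CompoundPoisson

open scoped NNReal

variable {V : Type*} [MeasurableSpace V] [AddCommMonoid V]

/-- The `n`-fold convolution power of `ρ`, the law of a sum of `n` independent variables of law
`ρ`. -/
noncomputable def convPow (ρ : Measure V) : ℕ → Measure V
  | 0 => Measure.dirac 0
  | n + 1 => convPow ρ n ∗ ρ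

/-- The law of a sum of `N` independent variables of law `ρ`, where `N` is an independent Poisson
variable of parameter `r`. -/
noncomputable def compoundPoisson (r : ℝ≥0) (ρ : Measure V) : Measure V :=
  (poissonMeasure r).bind (convPow ρ)

variable {ρ : Measure V} {g : V → ℝ≥0∞}

theorem lintegral_compoundPoisson (r : ℝ≥0) (hg : Measurable g) :
    ∫⁻ v, g v ∂compoundPoisson r ρ = ∫⁻ n, ∫⁻ v, g v ∂convPow ρ n ∂poissonMeasure r :=
  Measure.lintegral_bind Measurable.of_discrete.aemeasurable hg.aemeasurable

theorem compoundPoisson_zero : compoundPoisson 0 ρ = Measure.dirac 0 := by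
  rw [compoundPoisson, poissonMeasure_zero, Measure.dirac_bind .of_discrete, convPow]

variable [MeasurableAdd₂ V]

theorem convPow_one [SFinite ρ] : convPow ρ 1 = ρ :=
  Measure.dirac_zero_conv ρ

variable [IsProbabilityMeasure ρ]

instance isProbabilityMeasure_convPow (n : ℕ) : IsProbabilityMeasure (convPow ρ n) := by
  induction n with
  | zero => exact Measure.dirac.isProbabilityMeasure
  | succ n ih => exact Measure.probabilitymeasure_of_probabilitymeasures_conv _ _

instance isProbabilityMeasure_compoundPoisson (r : ℝ≥0) :
    IsProbabilityMeasure (compoundPoisson r ρ) :=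
  isProbabilityMeasure_bind Measurable.of_discrete.aemeasurable
    (.of_forall isProbabilityMeasure_convPow)

theorem convPow_add (m n : ℕ) : convPow ρ (m + n) = convPow ρ m ∗ convPow ρ n := by
  induction n with
  | zero => exact (Measure.conv_dirac_zero _).symm
  | succ n ih => rw [← add_assoc, convPow, ih, convPow, Measure.conv_assoc]

theorem evariance_convPow_succ_le {F : V → ℝ} {C : ℝ} (hF : Measurable F) (hC : ∀ v, ‖F v‖ ≤ C)
    (n : ℕ) :
    evariance F (convPow ρ (n + 1)) ≤ (n + 1) * ∫⁻ v, meanSqIncrement ρ F v ∂convPow ρ n := by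
  induction n generalizing F with
  | zero =>
    have hincrement : ∫⁻ v, meanSqIncrement ρ F v ∂convPow ρ 0 = ∫⁻ w, ‖F w - F 0‖ₑ ^ 2 ∂ρ := by
      rw [convPow, lintegral_dirac' _ (measurable_meanSqIncrement hF), meanSqIncrement]
      simp only [zero_add]
    rw [zero_add, convPow_one, hincrement, Nat.cast_zero, zero_add, one_mul]
    exact evariance_le_lintegral_enorm_sub_sq (memLp_of_forall_norm_le hF hC) (F 0)
  | succ n ih =>
    have hG (v : V) : ‖∫ w, F (v + w) ∂ρ‖ ≤ C := by
      simpa using norm_integral_le_of_norm_le_const (μ := ρ) (.of_forall fun w => hC (v + w))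
    calc evariance F (convPow ρ (n + 1 + 1))
        ≤ evariance (fun v => ∫ w, F (v + w) ∂ρ) (convPow ρ (n + 1)) +
            ∫⁻ v, meanSqIncrement ρ F v ∂convPow ρ (n + 1) := evariance_conv_le hF hC
      _ ≤ (n + 1) * ∫⁻ v, meanSqIncrement ρ F v ∂convPow ρ (n + 1) +
            ∫⁻ v, meanSqIncrement ρ F v ∂convPow ρ (n + 1) := by
          gcongr
          exact (ih (measurable_integral_translate hF) hG).trans
            (mul_le_mul_right (lintegral_meanSqIncrement_integral_translate_le hF hC) _)
      _ = ((n + 1 : ℕ) + 1) * ∫⁻ v, meanSqIncrement ρ F v ∂convPow ρ (n + 1) := by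
          push_cast
          ring

theorem compoundPoisson_add (r s : ℝ≥0) :
    compoundPoisson (r + s) ρ = compoundPoisson r ρ ∗ compoundPoisson s ρ := by
  refine Measure.ext_of_lintegral _ fun g hg => ?_
  have hinner (Q : Measure V) [SFinite Q] : Measurable fun v => ∫⁻ w, g (v + w) ∂Q :=
    Measurable.lintegral_prod_right (f := fun v w => g (v + w)) (hg.comp measurable_add)
  calc ∫⁻ v, g v ∂compoundPoisson (r + s) ρ
      = ∫⁻ m, ∫⁻ n, ∫⁻ v, ∫⁻ w, g (v + w) ∂convPow ρ n ∂convPow ρ m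
          ∂poissonMeasure s ∂poissonMeasure r := by
        rw [lintegral_compoundPoisson _ hg, ← poissonMeasure_conv_poissonMeasure,
          Measure.lintegral_conv .of_discrete]
        simp_rw [convPow_add, Measure.lintegral_conv hg]
    _ = ∫⁻ m, ∫⁻ v, ∫⁻ w, g (v + w) ∂compoundPoisson s ρ ∂convPow ρ m ∂poissonMeasure r := by
        refine lintegral_congr fun m => ?_
        rw [lintegral_lintegral_swap]
        · exact lintegral_congr fun v =>
            (lintegral_compoundPoisson s (hg.comp (measurable_const_add v))).symm
        · exact (measurable_from_prod_countable_right fun n => hinner (convPow ρ n)).aemeasurable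
    _ = ∫⁻ v, g v ∂(compoundPoisson r ρ ∗ compoundPoisson s ρ) := by
        rw [Measure.lintegral_conv hg, lintegral_compoundPoisson r (hinner _)]

theorem convPow_compoundPoisson (r : ℝ≥0) (n : ℕ) :
    convPow (compoundPoisson r ρ) n = compoundPoisson (n * r) ρ := by
  induction n with
  | zero => simp [convPow, compoundPoisson_zero]
  | succ n ih =>
    rw [convPow, ih, ← compoundPoisson_add]
    push_cast
    rw [add_one_mul]

theorem lintegral_compoundPoisson_le (r : ℝ≥0) {D : ℝ≥0∞} (hg : Measurable g) (hg0 : g 0 = 0)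
    (hD : ∀ v, g v ≤ D) :
    ∫⁻ v, g v ∂compoundPoisson r ρ ≤ r * ∫⁻ v, g v ∂ρ + r ^ 2 * D := by
  have hn (n : ℕ) : ∫⁻ v, g v ∂convPow ρ n ≤
      ({1} : Set ℕ).indicator (fun _ => ∫⁻ v, g v ∂ρ) n + (Set.Ici 2).indicator (fun _ => D) n := by
    match n with
    | 0 => simp [convPow, lintegral_dirac' _ hg, hg0]
    | 1 => simp [convPow_one]
    | n + 2 => simpa using lintegral_mono (μ := convPow ρ (n + 2)) hD
  calc ∫⁻ v, g v ∂compoundPoisson r ρ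
      ≤ ∫⁻ n, (({1} : Set ℕ).indicator (fun _ => ∫⁻ v, g v ∂ρ) n +
          (Set.Ici 2).indicator (fun _ => D) n) ∂poissonMeasure r := by
        rw [lintegral_compoundPoisson r hg]
        exact lintegral_mono hn
    _ = (∫⁻ v, g v ∂ρ) * poissonMeasure r {1} + D * poissonMeasure r (Set.Ici 2) := by
        rw [lintegral_add_left .of_discrete, lintegral_indicator_const (measurableSet_singleton 1),
          lintegral_indicator_const measurableSet_Ici]
    _ ≤ r * ∫⁻ v, g v ∂ρ + r ^ 2 * D := by
        rw [mul_comm, mul_comm D]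
        gcongr
        exacts [poissonMeasure_singleton_one_le r, poissonMeasure_Ici_two_le r]

theorem exp_neg_mul_lintegral_compoundPoisson_le (r s : ℝ≥0) (hg : Measurable g) :
    ENNReal.ofReal (Real.exp (-s)) * ∫⁻ v, g v ∂compoundPoisson r ρ ≤
      ∫⁻ v, g v ∂compoundPoisson (r + s) ρ := by
  rw [compoundPoisson_add, Measure.lintegral_conv hg, ← lintegral_const_mul _ hg]
  refine lintegral_mono fun v => ?_
  have hgv : Measurable fun w => g (v + w) := hg.comp (measurable_const_add v)
  calc ENNReal.ofReal (Real.exp (-s)) * g v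
      = ∫⁻ n in {0}, ∫⁻ w, g (v + w) ∂convPow ρ n ∂poissonMeasure s := by
        rw [lintegral_singleton, poissonMeasure_singleton, convPow, lintegral_dirac' _ hgv]
        simp [mul_comm]
    _ ≤ ∫⁻ w, g (v + w) ∂compoundPoisson s ρ := by
        rw [lintegral_compoundPoisson s hgv]
        exact setLIntegral_le_lintegral _ _

-- A compound Poisson variable of parameter `n * h + h` is a sum of `n + 1` pieces of parameter `h`,
-- and each piece consists of at most one step, up to an error of second order in `h`.
theorem evariance_compoundPoisson_succ_mul_le (n : ℕ) (h : ℝ≥0) {F : V → ℝ} {C : ℝ}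
    (hF : Measurable F) (hC : ∀ v, ‖F v‖ ≤ C) :
    evariance F (compoundPoisson (n * h + h) ρ) ≤
      (n * h + h) * (∫⁻ v, meanSqIncrement ρ F v ∂compoundPoisson (n * h) ρ +
        h * ENNReal.ofReal (2 * C) ^ 2) := by
  have hD (v w : V) : ‖F (v + w) - F v‖ₑ ^ 2 ≤ ENNReal.ofReal (2 * C) ^ 2 := by
    rw [← ofReal_norm]
    gcongr
    linarith [norm_sub_le (F (v + w)) (F v), hC (v + w), hC v]
  set D := ENNReal.ofReal (2 * C) ^ 2
  have hpiece (v : V) :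
      meanSqIncrement (compoundPoisson h ρ) F v ≤ h * meanSqIncrement ρ F v + h ^ 2 * D :=
    lintegral_compoundPoisson_le h
      (((hF.comp (measurable_const_add v)).sub_const _).enorm.pow_const 2) (by simp) (hD v)
  calc evariance F (compoundPoisson (n * h + h) ρ)
      ≤ (n + 1) * ∫⁻ v, meanSqIncrement (compoundPoisson h ρ) F v ∂compoundPoisson (n * h) ρ := by
        have := evariance_convPow_succ_le (ρ := compoundPoisson h ρ) hF hC n
        rwa [convPow_compoundPoisson, convPow_compoundPoisson, Nat.cast_succ, add_one_mul] at this
    _ ≤ (n + 1) * ∫⁻ v, (h * meanSqIncrement ρ F v + h ^ 2 * D) ∂compoundPoisson (n * h) ρ := by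
        gcongr with v
        exact hpiece v
    _ = (n * h + h) * (∫⁻ v, meanSqIncrement ρ F v ∂compoundPoisson (n * h) ρ + h * D) := by
        rw [lintegral_add_right _ measurable_const,
          lintegral_const_mul _ (measurable_meanSqIncrement hF), lintegral_const, measure_univ]
        ring

theorem exp_neg_mul_evariance_compoundPoisson_le (n : ℕ) (h : ℝ≥0) {F : V → ℝ} {C : ℝ}
    (hF : Measurable F) (hC : ∀ v, ‖F v‖ ≤ C) :
    ENNReal.ofReal (Real.exp (-h)) * evariance F (compoundPoisson (n * h + h) ρ) ≤
      (n * h + h) * (∫⁻ v, meanSqIncrement ρ F v ∂compoundPoisson (n * h + h) ρ +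
        h * ENNReal.ofReal (2 * C) ^ 2) := by
  set D := ENNReal.ofReal (2 * C) ^ 2
  set c := ENNReal.ofReal (Real.exp (-h))
  have hc : c ≤ 1 := by simp [c]
  calc c * evariance F (compoundPoisson (n * h + h) ρ)
      ≤ c * ((n * h + h) *
          (∫⁻ v, meanSqIncrement ρ F v ∂compoundPoisson (n * h) ρ + h * D)) := by
        gcongr
        exact evariance_compoundPoisson_succ_mul_le n h hF hC
    _ = (n * h + h) * (c * ∫⁻ v, meanSqIncrement ρ F v ∂compoundPoisson (n * h) ρ +
          c * (h * D)) := by ring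
    _ ≤ (n * h + h) * (∫⁻ v, meanSqIncrement ρ F v ∂compoundPoisson (n * h + h) ρ + h * D) :=
        mul_le_mul_right (add_le_add
          (exp_neg_mul_lintegral_compoundPoisson_le _ _ (measurable_meanSqIncrement hF))
          (mul_le_of_le_one_left' hc)) _

theorem evariance_compoundPoisson_le_of_forall_norm_le (r : ℝ≥0) {F : V → ℝ} {C : ℝ}
    (hF : Measurable F) (hC : ∀ v, ‖F v‖ ≤ C) :
    evariance F (compoundPoisson r ρ) ≤
      r * ∫⁻ v, meanSqIncrement ρ F v ∂compoundPoisson r ρ := by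
  have hpieces (n : ℕ) : ENNReal.ofReal (Real.exp (-(r / (n + 1) : ℝ≥0))) *
      evariance F (compoundPoisson r ρ) ≤
        r * (∫⁻ v, meanSqIncrement ρ F v ∂compoundPoisson r ρ +
          (r / (n + 1) : ℝ≥0) * ENNReal.ofReal (2 * C) ^ 2) := by
    have hsplit : n * (r / (n + 1)) + r / (n + 1) = r := by field_simp
    have h := exp_neg_mul_evariance_compoundPoisson_le (ρ := ρ) n (r / (n + 1)) hF hC
    rwa [← ENNReal.coe_natCast, ← ENNReal.coe_mul, ← ENNReal.coe_add, hsplit] at h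
  have hlim : Filter.Tendsto (fun n : ℕ => (r / (n + 1) : ℝ≥0)) Filter.atTop (nhds 0) :=
    NNReal.tendsto_coe.1 <| by
      simpa [Function.comp_def] using
        (tendsto_const_div_atTop_nhds_zero_nat (r : ℝ)).comp (Filter.tendsto_add_atTop_nat 1)
  have hexp : Continuous fun h : ℝ≥0 => ENNReal.ofReal (Real.exp (-h)) :=
    ENNReal.continuous_ofReal.comp (by fun_prop)
  have hleft := ENNReal.Tendsto.mul_const (b := evariance F (compoundPoisson r ρ))
    ((hexp.tendsto 0).comp hlim) (.inl (by simp))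
  have hright := ENNReal.Tendsto.const_mul (a := (r : ℝ≥0∞))
    (tendsto_const_nhds (x := ∫⁻ v, meanSqIncrement ρ F v ∂compoundPoisson r ρ) |>.add
      (ENNReal.Tendsto.mul_const (b := ENNReal.ofReal (2 * C) ^ 2)
        (ENNReal.tendsto_coe.2 hlim) (.inr (by finiteness)))) (.inr ENNReal.coe_ne_top)
  simpa using le_of_tendsto_of_tendsto' hleft hright hpieces

theorem evariance_compoundPoisson_le (r : ℝ≥0) {F : V → ℝ} (hF : Measurable F)
    (hF1 : Integrable F (compoundPoisson r ρ)) :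
    evariance F (compoundPoisson r ρ) ≤
      r * ∫⁻ v, meanSqIncrement ρ F v ∂compoundPoisson r ρ := by
  refine evariance_le_of_forall_clamp_le hF1 fun n => ?_
  refine (evariance_compoundPoisson_le_of_forall_norm_le r
    ((continuous_clamp n).measurable.comp hF) fun v => norm_clamp_le n (F v)).trans ?_
  simp only [meanSqIncrement]
  gcongr with v w
  exact enorm_le_iff_norm_le.2 (norm_clamp_sub_clamp_le n _ _)

end CompoundPoisson

section CharacteristicFunction

open scoped NNReal

theorem ext_of_forall_integral_exp_finset_sum {ι : Type*} {μ ν : Measure (ι → ℝ)}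
    [IsFiniteMeasure μ] [IsFiniteMeasure ν]
    (h : ∀ (s : Finset ι) (c : s → ℝ),
      ∫ v, Complex.exp ((∑ i, c i * v i : ℝ) * Complex.I) ∂μ =
        ∫ v, Complex.exp ((∑ i, c i * v i : ℝ) * Complex.I) ∂ν) :
    μ = ν := by
  classical
  have hcharFun (P : Measure (ι → ℝ)) (s : Finset ι) (L : StrongDual ℝ (s → ℝ)) :
      charFunDual (P.map s.restrict) L =
        ∫ v, Complex.exp ((∑ i, L (Pi.single i 1) * v i : ℝ) * Complex.I) ∂P := by
    rw [charFunDual_apply, integral_map (Finset.measurable_restrict s).aemeasurable (by fun_prop)]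
    refine integral_congr_ae (.of_forall fun v => ?_)
    have hL : L (s.restrict v) = ∑ i : s, L (Pi.single i 1) * v i := by
      rw [pi_eq_sum_univ' (s.restrict v), map_sum]
      simp [mul_comm]
    simp only [hL]
  have hmarginal (s : Finset ι) : μ.map s.restrict = ν.map s.restrict :=
    Measure.ext_of_charFunDual (funext fun L => by rw [hcharFun, hcharFun, h])
  exact IsProjectiveLimit.unique (fun _ => rfl) fun s => (hmarginal s).symm

theorem integral_pow_poissonMeasure (r : ℝ≥0) (z : ℂ) :
    ∫ n, z ^ n ∂poissonMeasure r = Complex.exp (r * (z - 1)) := by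
  have hterm (n : ℕ) : (Real.exp (-r) * r ^ n / n.factorial) • z ^ n =
      Complex.exp (-r) * ((r * z) ^ n / n.factorial) := by
    rw [Complex.real_smul]
    push_cast
    ring
  simp_rw [integral_poissonMeasure, hterm, tsum_mul_left,
    (NormedSpace.expSeries_div_hasSum_exp (r * z)).tsum_eq, ← Complex.exp_eq_exp_ℂ,
    ← Complex.exp_add]
  ring_nf

variable {V : Type*} [MeasurableSpace V] [AddCommMonoid V] {ρ : Measure V} {χ : AddChar V Circle}

theorem integral_compoundPoisson {E : Type*} [NormedAddCommGroup E] [NormedSpace ℝ E] {r : ℝ≥0}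
    {f : V → E} (hf : Integrable f (compoundPoisson r ρ)) :
    ∫ v, f v ∂compoundPoisson r ρ = ∫ n, ∫ v, f v ∂convPow ρ n ∂poissonMeasure r := by
  let κ : Kernel ℕ V := ⟨convPow ρ, .of_discrete⟩
  have hκ : compoundPoisson r ρ = (κ ∘ₖ Kernel.const Unit (poissonMeasure r)) () :=
    Measure.comp_eq_comp_const_apply (κ := κ)
  rw [hκ] at hf ⊢
  exact Kernel.integral_comp hf

theorem integrable_addChar (hχ : Measurable fun v => (χ v : ℂ)) (Q : Measure V)
    [IsFiniteMeasure Q] : Integrable (fun v => (χ v : ℂ)) Q :=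
  .of_bound hχ.aestronglyMeasurable 1 (.of_forall fun v => (Circle.norm_coe (χ v)).le)

variable [MeasurableAdd₂ V] [IsProbabilityMeasure ρ]

theorem integral_addChar_convPow (hχ : Measurable fun v => (χ v : ℂ)) (n : ℕ) :
    ∫ v, (χ v : ℂ) ∂convPow ρ n = (∫ v, (χ v : ℂ) ∂ρ) ^ n := by
  induction n with
  | zero => rw [convPow, integral_dirac' _ _ hχ.stronglyMeasurable]; simp
  | succ n ih =>
    rw [pow_succ, ← ih, ← integral_mul_const, convPow, integral_conv (integrable_addChar hχ _)]
    simp_rw [AddChar.map_add_eq_mul, Circle.coe_mul, integral_const_mul]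

theorem integral_addChar_compoundPoisson (r : ℝ≥0) (hχ : Measurable fun v => (χ v : ℂ)) :
    ∫ v, (χ v : ℂ) ∂compoundPoisson r ρ = Complex.exp (r * (∫ v, (χ v : ℂ) ∂ρ - 1)) := by
  simp_rw [integral_compoundPoisson (integrable_addChar hχ _), integral_addChar_convPow hχ,
    integral_pow_poissonMeasure]

end CharacteristicFunction

section LayerCake

theorem tsum_odd_mul_indicator_Ioi (d : ℕ) :
    ∑' j : ℕ, (2 * j + 1 : ℝ≥0∞) * (Set.Ioi j).indicator 1 d = (d : ℝ≥0∞) ^ 2 := by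
  rw [tsum_eq_sum (s := Finset.range d) fun j hj => by simpa using hj,
    Finset.sum_congr rfl fun j hj => by
      rw [Set.indicator_of_mem (Set.mem_Ioi.2 (Finset.mem_range.1 hj)), Pi.one_apply, mul_one]]
  induction d with
  | zero => simp
  | succ d ih =>
    rw [Finset.sum_range_succ, ih]
    push_cast
    ring

theorem tsum_odd_mul_indicator_singleton (d : ℕ) :
    ∑' j : ℕ, (2 * j + 1 : ℝ≥0∞) *
      (({j} : Set ℕ).indicator 1 d + ({j + 1} : Set ℕ).indicator 1 d) =
      4 * d + ({0} : Set ℕ).indicator 1 d := by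
  simp_rw [mul_add]
  rw [ENNReal.tsum_add, tsum_eq_single d fun j hj => by simp [hj.symm]]
  rcases d with _ | d
  · simp
  · rw [tsum_eq_single d fun j hj => by simp [hj.symm]]
    simp
    ring

theorem lintegral_sq_eq_tsum_measure_Ioi (ν : Measure ℕ) :
    ∫⁻ d, (d : ℝ≥0∞) ^ 2 ∂ν = ∑' j : ℕ, (2 * j + 1 : ℝ≥0∞) * ν (Set.Ioi j) := by
  simp_rw [← tsum_odd_mul_indicator_Ioi]
  rw [lintegral_tsum fun j => Measurable.of_discrete.aemeasurable]
  refine tsum_congr fun j => ?_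
  rw [lintegral_const_mul _ .of_discrete, lintegral_indicator_one .of_discrete]

theorem mul_lintegral_sq_le_of_measure_Ioi_le {ν : Measure ℕ} {C : ℝ≥0∞}
    (h : ∀ j, C * ν (Set.Ioi j) ≤ ν {j} + ν {j + 1}) :
    C * ∫⁻ d, (d : ℝ≥0∞) ^ 2 ∂ν ≤ 4 * ∫⁻ d, (d : ℝ≥0∞) ∂ν + ν {0} :=
  calc C * ∫⁻ d, (d : ℝ≥0∞) ^ 2 ∂ν
      = ∑' j : ℕ, (2 * j + 1 : ℝ≥0∞) * (C * ν (Set.Ioi j)) := by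
        rw [lintegral_sq_eq_tsum_measure_Ioi, ← ENNReal.tsum_mul_left]
        exact tsum_congr fun j => mul_left_comm _ _ _
    _ ≤ ∑' j : ℕ, (2 * j + 1 : ℝ≥0∞) * (ν {j} + ν {j + 1}) := by gcongr with j; exact h j
    _ = ∫⁻ d, ∑' j : ℕ, (2 * j + 1 : ℝ≥0∞) *
          (({j} : Set ℕ).indicator 1 d + ({j + 1} : Set ℕ).indicator 1 d) ∂ν := by
        rw [lintegral_tsum fun j => Measurable.of_discrete.aemeasurable]
        refine tsum_congr fun j => ?_
        rw [lintegral_const_mul _ .of_discrete, lintegral_add_left .of_discrete,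
          lintegral_indicator_one .of_discrete, lintegral_indicator_one .of_discrete]
    _ = 4 * ∫⁻ d, (d : ℝ≥0∞) ∂ν + ν {0} := by
        simp_rw [tsum_odd_mul_indicator_singleton]
        rw [lintegral_add_left .of_discrete, lintegral_const_mul _ .of_discrete,
          lintegral_indicator_one .of_discrete]

end LayerCake

theorem exists_nat_median (ν : Measure ℕ) [IsProbabilityMeasure ν] :
    ∃ m, ν (Set.Iio m) < 1 / 2 ∧ ν (Set.Ioi m) ≤ 1 / 2 := by
  classical
  have hex : ∃ m : ℕ, 1 / 2 ≤ ν (Set.Iic m) :=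
    ((tendsto_measure_Iic_atTop ν).eventually (lt_mem_nhds (by simp))).exists.imp fun _ => le_of_lt
  refine ⟨Nat.find hex, ?_, ?_⟩
  · rcases hm : Nat.find hex with _ | k
    · simp
    · have hIio : Set.Iio (k + 1) = Set.Iic k := Set.ext fun _ => Nat.lt_succ_iff
      rw [hIio]
      exact not_le.1 (Nat.find_min hex (by lia))
  · rw [← Set.compl_Iic, prob_compl_eq_one_sub .of_discrete]
    exact (tsub_le_tsub_left (Nat.find_spec hex) 1).trans_eq (by simp)

theorem enorm_natCast_sub_natCast (n m : ℕ) :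
    ‖(n : ℝ) - m‖ₑ = ((n - m : ℕ) : ℝ≥0∞) + (m - n : ℕ) := by
  rcases le_total n m with h | h
  · rw [enorm_sub_rev, ← Nat.cast_sub h, Real.enorm_natCast, Nat.sub_eq_zero_of_le h, Nat.cast_zero,
      zero_add]
  · rw [← Nat.cast_sub h, Real.enorm_natCast, Nat.sub_eq_zero_of_le h, Nat.cast_zero, add_zero]

theorem enorm_natCast_sub_natCast_sq (n m : ℕ) :
    ‖(n : ℝ) - m‖ₑ ^ 2 = ((n - m : ℕ) : ℝ≥0∞) ^ 2 + ((m - n : ℕ) : ℝ≥0∞) ^ 2 := by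
  rw [enorm_natCast_sub_natCast]
  rcases le_total n m with h | h <;> simp [Nat.sub_eq_zero_of_le h]

theorem sq_rpow_half_sub_one_div_four_le {C s : ℝ≥0∞} (hs : s ≠ ∞)
    (h : C * s ^ 2 ≤ 4 * s + 2) : ((C + 1) ^ (1 / 2 : ℝ) - 1) ^ 2 / 4 ≤ 1 / s ^ 2 := by
  rcases eq_or_ne s 0 with rfl | hs0
  · simp
  have hsq : ((C + 1) ^ (1 / 2 : ℝ)) ^ 2 = C + 1 := by
    rw [← ENNReal.rpow_natCast, ← ENNReal.rpow_mul]
    simp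
  have hmul : (C + 1) ^ (1 / 2 : ℝ) * s ≤ s + 2 := by
    refine (ENNReal.pow_le_pow_left_iff two_ne_zero).1 ?_
    calc ((C + 1) ^ (1 / 2 : ℝ) * s) ^ 2 = C * s ^ 2 + s ^ 2 := by rw [mul_pow, hsq]; ring
      _ ≤ 4 * s + 4 + s ^ 2 := by gcongr; exact h.trans (by gcongr; norm_num)
      _ = (s + 2) ^ 2 := by ring
  have hsub : ((C + 1) ^ (1 / 2 : ℝ) - 1) * s ≤ 2 := by
    rw [ENNReal.sub_mul fun _ _ => hs, one_mul, tsub_le_iff_left]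
    exact hmul
  rw [ENNReal.le_div_iff_mul_le (by simp [hs0]) (by simp [hs]),
    ← ENNReal.mul_div_right_comm, ← mul_pow]
  refine ENNReal.div_le_of_le_mul ((pow_le_pow_left' hsub 2).trans_eq ?_)
  norm_num

theorem ofReal_prod_poisson_eq {ι : Type*} [Fintype ι] (r : ι → ℝ≥0∞) (k : ι → ℕ) :
    ENNReal.ofReal
      (∏ i, (r i).toReal ^ k i / (k i).factorial * Real.exp (-(r i).toReal)) =
      ∏ i, poissonMeasure (r i).toNNReal {k i} := by
  rw [ENNReal.ofReal_prod_of_nonneg fun i _ => by positivity]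
  refine Finset.prod_congr rfl fun i _ => ?_
  rw [poissonMeasure_singleton, ENNReal.coe_toNNReal_eq_toReal]
  ring_nf

theorem integral_comp_simpleFunc {X E : Type*} [MeasurableSpace X] [NormedAddCommGroup E]
    [NormedSpace ℝ E] [CompleteSpace E] {g : ℝ → E} (hg : g 0 = 0) (f : SimpleFunc X ℝ)
    (v : Measure X) [IsFiniteMeasure v] :
    ∫ x, g (f x) ∂v = ∑ y : f.range, v.real (f ⁻¹' {(y : ℝ)}) • g y :=
  calc ∫ x, g (f x) ∂v
      = (f.map g).integral v :=
        ((f.map g).integral_eq_integral (f.map g).integrable_of_isFiniteMeasure).symm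
    _ = ∑ y ∈ f.range, v.real (f ⁻¹' {y}) • g y :=
        f.map_integral g f.integrable_of_isFiniteMeasure hg
    _ = ∑ y : f.range, v.real (f ⁻¹' {(y : ℝ)}) • g y := (Finset.sum_coe_sort _ _).symm

namespace Configuration

section Number

variable {X : Type*} [TopologicalSpace X] {ω : Configuration X} {x : X}

theorem number_ne_top (hω : ω.number Set.univ ≠ ⊤) (B : Set X) : ω.number B ≠ ⊤ :=
  ne_top_of_le_ne_top hω (Set.encard_le_encard (Set.inter_subset_inter_right _ (Set.subset_univ B)))

theorem number_addPoint (hx : x ∉ ω.carrier) (B : Set X) :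
    (ω.addPoint x).number B = ω.number B + B.indicator 1 x := by
  by_cases hB : x ∈ B
  · simp [number, addPoint, Set.insert_inter_of_mem hB, Set.encard_insert_of_notMem, hx, hB]
  · simp [number, addPoint, Set.insert_inter_of_notMem hB, hB]

theorem toNat_number_addPoint (hω : ω.number Set.univ ≠ ⊤) (hx : x ∉ ω.carrier) (B : Set X) :
    ((ω.addPoint x).number B).toNat = (ω.number B).toNat + B.indicator 1 x := by
  rw [number_addPoint hx, ENat.toNat_add (number_ne_top hω B)]
  · by_cases hB : x ∈ B <;> simp [hB]
  · by_cases hB : x ∈ B <;> simp [hB]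

theorem number_removePoint_add_one (hx : x ∈ ω.carrier) :
    (ω.removePoint x).number Set.univ + 1 = ω.number Set.univ := by
  simp only [number, removePoint, Set.inter_univ]
  exact Set.encard_sdiff_singleton_add_one hx

theorem toNat_number_removePoint_add_one (hω : ω.number Set.univ ≠ ⊤) (hx : x ∈ ω.carrier) :
    ((ω.removePoint x).number Set.univ).toNat + 1 = (ω.number Set.univ).toNat := by
  rw [← number_removePoint_add_one hx] at hω ⊢
  rw [ENat.toNat_add (by simpa using hω) (by simp), ENat.toNat_one]

variable [MeasurableSpace X] {B : Set X}

theorem toMeasure_apply (ω : Configuration X) (hB : MeasurableSet B) :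
    ω.toMeasure B = (ω.number B : ℝ≥0∞) := by
  rw [toMeasure, Measure.sum_apply _ hB, number, ← ENNReal.tsum_set_one]
  simp_rw [Measure.dirac_apply' _ hB]
  rw [tsum_subtype ω.carrier (B.indicator 1), tsum_subtype (ω.carrier ∩ B) (fun _ => (1 : ℝ≥0∞)),
    Set.indicator_indicator]
  rfl

theorem toMeasure_real (ω : Configuration X) (hB : MeasurableSet B) :
    ω.toMeasure.real B = (ω.number B).toNat := by
  rw [Measure.real, toMeasure_apply _ hB]
  cases ω.number B <;> simp

theorem isFiniteMeasure_toMeasure (hω : ω.number Set.univ ≠ ⊤) : IsFiniteMeasure ω.toMeasure :=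
  ⟨by simpa [toMeasure_apply ω .univ] using hω.lt_top⟩

theorem measurable_number (hB : MeasurableSet B) :
    Measurable fun ω : Configuration X => ω.number B :=
  measurable_iff_comap_le.2 <| le_iSup₂ (f := fun (B : Set X) (_ : MeasurableSet B) =>
    MeasurableSpace.comap (fun ω : Configuration X => number ω B) ⊤) B hB

theorem measurable_toNat_number (hB : MeasurableSet B) :
    Measurable fun ω : Configuration X => (ω.number B).toNat :=
  (Measurable.of_discrete (f := ENat.toNat)).comp (measurable_number hB)

end Number

section PoissonLaw

variable {X : Type*} [TopologicalSpace X] [MeasurableSpace X] {σ : Measure X}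
  {π : Measure (Configuration X)} {ι : Type*} [Fintype ι] {A : ι → Set X}

theorem IsPoissonMeasure.isProbabilityMeasure (hπ : IsPoissonMeasure σ π) :
    IsProbabilityMeasure π :=
  ⟨by simpa using hπ 0 Fin.elim0 (fun i => i.elim0) (fun i => i.elim0) Fin.elim0⟩

theorem IsPoissonMeasure.measure_forall_number_eq (hπ : IsPoissonMeasure σ π)
    (hA : ∀ i, MeasurableSet (A i)) (hd : Pairwise (Function.onFun Disjoint A)) (k : ι → ℕ) :
    π {ω | ∀ i, ω.number (A i) = k i} = ∏ i, poissonMeasure (σ (A i)).toNNReal {k i} := by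
  let e := Fintype.equivFin ι
  have h := hπ _ (A ∘ e.symm) (fun i => hA _) (hd.comp_of_injective e.symm.injective) (k ∘ e.symm)
  simp only [Function.comp_apply, e.symm.forall_congr_left, Equiv.symm_symm,
    e.symm_apply_apply] at h
  rw [h]
  refine Eq.trans ?_ (ofReal_prod_poisson_eq (fun i => σ (A i)) k)
  rw [← e.symm.prod_comp]
  rfl

theorem IsPoissonMeasure.ae_number_univ_ne_top (hπ : IsPoissonMeasure σ π) :
    ∀ᵐ ω ∂π, ω.number Set.univ ≠ ⊤ := by
  have := hπ.isProbabilityMeasure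
  have hmeas (k : ℕ) : MeasurableSet {ω : Configuration X | ω.number Set.univ = k} :=
    measurable_number .univ (measurableSet_singleton (k : ℕ∞))
  have hlaw (k : ℕ) : π {ω | ω.number Set.univ = k} =
      poissonMeasure (σ Set.univ).toNNReal {k} := by
    simpa using hπ.measure_forall_number_eq (ι := Unit) (A := fun _ => Set.univ)
      (fun _ => .univ) (fun i j hij => absurd (Subsingleton.elim i j) hij) fun _ => k
  have hdisjoint : Pairwise (Function.onFun Disjoint fun k : ℕ =>
      {ω : Configuration X | ω.number Set.univ = k}) := fun i j hij =>
    Set.disjoint_left.2 fun ω hi hj => hij <| Nat.cast_injective <|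
      Set.mem_ofPred_eq.mp hi |>.symm.trans hj
  have hunion : π (⋃ k : ℕ, {ω : Configuration X | ω.number Set.univ = k}) = 1 := by
    simp_rw [measure_iUnion hdisjoint hmeas, hlaw]
    simpa using Measure.tsum_indicator_apply_singleton
      (poissonMeasure (σ Set.univ).toNNReal) Set.univ .univ
  filter_upwards [(mem_ae_iff_prob_eq_one (.iUnion hmeas)).2 hunion] with ω hω
  obtain ⟨k, hk⟩ := Set.mem_iUnion.1 hω
  exact hk ▸ ENat.natCast_ne_top k

theorem IsPoissonMeasure.map_toNat_number (hπ : IsPoissonMeasure σ π)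
    (hA : ∀ i, MeasurableSet (A i)) (hd : Pairwise (Function.onFun Disjoint A)) :
    π.map (fun ω i => (ω.number (A i)).toNat) =
      Measure.pi fun i => poissonMeasure (σ (A i)).toNNReal := by
  refine Measure.ext_of_singleton fun k => ?_
  rw [Measure.map_apply (measurable_pi_lambda _ fun i => measurable_toNat_number (hA i))
    (measurableSet_singleton k), Measure.pi_singleton, ← hπ.measure_forall_number_eq hA hd k]
  refine measure_congr (hπ.ae_number_univ_ne_top.mono fun ω hω => propext ?_)
  change (fun i => (ω.number (A i)).toNat) = k ↔ ∀ i, ω.number (A i) = k i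
  refine funext_iff.trans (forall_congr' fun i => ?_)
  rw [← ENat.natCast_toNat (number_ne_top hω (A i))]
  simp

theorem IsPoissonMeasure.map_toNat_number_univ (hπ : IsPoissonMeasure σ π) :
    π.map (fun ω => (ω.number Set.univ).toNat) = poissonMeasure (σ Set.univ).toNNReal := by
  have h := hπ.map_toNat_number (ι := Unit) (A := fun _ => Set.univ) (fun _ => .univ)
    fun i j hij => absurd (Subsingleton.elim i j) hij
  rw [← (measurePreserving_eval (fun _ : Unit => poissonMeasure (σ Set.univ).toNNReal) ()).map_eq,
    ← h, Measure.map_map (measurable_pi_apply ())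
      (measurable_pi_lambda _ fun _ => measurable_toNat_number .univ)]
  rfl

theorem IsPoissonMeasure.integral_exp_simpleFunc [IsFiniteMeasure σ] (hπ : IsPoissonMeasure σ π)
    (f : SimpleFunc X ℝ) :
    ∫ ω, Complex.exp ((∫ x, f x ∂ω.toMeasure : ℝ) * Complex.I) ∂π =
      Complex.exp (∫ x, (Complex.exp (f x * Complex.I) - 1) ∂σ) := by
  have hA (y : f.range) : MeasurableSet (f ⁻¹' {(y : ℝ)}) := f.measurableSet_fiber y
  have hd : Pairwise (Function.onFun Disjoint fun y : f.range => f ⁻¹' {(y : ℝ)}) :=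
    fun y z hyz => Disjoint.preimage f (Set.disjoint_singleton.2 fun h => hyz (Subtype.ext h))
  calc ∫ ω, Complex.exp ((∫ x, f x ∂ω.toMeasure : ℝ) * Complex.I) ∂π
      = ∫ ω, ∏ y : f.range,
          Complex.exp (y * Complex.I) ^ (ω.number (f ⁻¹' {(y : ℝ)})).toNat ∂π := by
        refine integral_congr_ae (hπ.ae_number_univ_ne_top.mono fun ω hω => ?_)
        have := isFiniteMeasure_toMeasure hω
        simp_rw [integral_comp_simpleFunc (g := fun y => y) rfl, toMeasure_real ω (hA _),
          smul_eq_mul, ← Complex.exp_nat_mul]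
        rw [← Complex.exp_sum, Complex.ofReal_sum, Finset.sum_mul]
        simp [mul_assoc]
    _ = ∫ n : f.range → ℕ, ∏ y : f.range, Complex.exp (y * Complex.I) ^ n y
          ∂Measure.pi fun y : f.range => poissonMeasure (σ (f ⁻¹' {(y : ℝ)})).toNNReal := by
        rw [← hπ.map_toNat_number hA hd, integral_map (measurable_pi_lambda _ fun y =>
          measurable_toNat_number (hA y)).aemeasurable Measurable.of_discrete.aestronglyMeasurable]
    _ = ∏ y : f.range, Complex.exp
          (σ.real (f ⁻¹' {(y : ℝ)}) * (Complex.exp (y * Complex.I) - 1)) := by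
        rw [integral_fintype_prod_eq_prod
          fun (y : f.range) (n : ℕ) => Complex.exp (y * Complex.I) ^ n]
        simp_rw [integral_pow_poissonMeasure, ENNReal.coe_toNNReal_eq_toReal]
        rfl
    _ = Complex.exp (∫ x, (Complex.exp (f x * Complex.I) - 1) ∂σ) := by
        rw [← Complex.exp_sum, integral_comp_simpleFunc
          (g := fun y => Complex.exp (y * Complex.I) - 1) (by simp)]
        simp_rw [Complex.real_smul]

end PoissonLaw

section PointVector

variable {X : Type*} [MeasurableSpace X]

/-- The vector, indexed by the measurable sets, of the numbers of points of `{x}` in them. -/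
noncomputable def pointVector (x : X) : {B : Set X // MeasurableSet B} → ℝ :=
  fun B => (B : Set X).indicator 1 x

theorem measurable_pointVector :
    Measurable (pointVector : X → {B : Set X // MeasurableSet B} → ℝ) :=
  measurable_pi_lambda _ fun B => measurable_one.indicator B.2

theorem exists_simpleFunc_eq_sum_mul_pointVector (s : Finset {B : Set X // MeasurableSet B})
    (c : s → ℝ) : ∃ f : SimpleFunc X ℝ, ∀ x, f x = ∑ i, c i * pointVector x i := by
  classical
  have hmeas : Measurable fun x : X => ∑ i, c i * pointVector x i :=
    Finset.measurable_sum _ fun i _ =>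
      ((measurable_pi_apply _).comp measurable_pointVector).const_mul _
  have hfinite : (Set.range fun x : X => ∑ i, c i * pointVector x i).Finite := by
    refine (Set.finite_range fun p : s → Prop => ∑ i, c i * if p i then 1 else 0).subset ?_
    rintro _ ⟨x, rfl⟩
    exact ⟨fun i => x ∈ (i : Set X), by simp [pointVector, Set.indicator_apply]⟩
  exact ⟨⟨_, fun y => hmeas (measurableSet_singleton y), hfinite⟩, fun _ => rfl⟩

theorem integral_sum_mul_pointVector (v : Measure X) [IsFiniteMeasure v]
    (s : Finset {B : Set X // MeasurableSet B}) (c : s → ℝ) :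
    ∫ x, ∑ i, c i * pointVector x i ∂v = ∑ i : s, c i * v.real i := by
  rw [integral_finsetSum]
  · refine Finset.sum_congr rfl fun i _ => ?_
    rw [integral_const_mul]
    exact congrArg _ (integral_indicator_one i.1.2)
  · exact fun i _ => ((integrable_const (1 : ℝ)).indicator i.1.2).const_mul _

theorem integral_exp_sum_compoundPoisson (σ : Measure X) [IsFiniteMeasure σ] [NeZero σ]
    (s : Finset {B : Set X // MeasurableSet B}) (c : s → ℝ) :
    ∫ v, Complex.exp ((∑ i, c i * v i : ℝ) * Complex.I)
        ∂compoundPoisson (σ Set.univ).toNNReal (((σ Set.univ)⁻¹ • σ).map pointVector) =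
      Complex.exp
        (∫ x, (Complex.exp ((∑ i, c i * pointVector x i : ℝ) * Complex.I) - 1) ∂σ) := by
  have := Measure.isProbabilityMeasure_map (μ := (σ Set.univ)⁻¹ • σ)
    measurable_pointVector.aemeasurable
  let L : ({B : Set X // MeasurableSet B} → ℝ) →+ ℝ :=
    { toFun v := ∑ i, c i * v i
      map_zero' := by simp
      map_add' v w := by simp [mul_add, Finset.sum_add_distrib] }
  let χ : AddChar ({B : Set X // MeasurableSet B} → ℝ) Circle := Real.probChar.compAddMonoidHom L
  have hχ_apply (v : {B : Set X // MeasurableSet B} → ℝ) :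
      (χ v : ℂ) = Complex.exp ((∑ i, c i * v i : ℝ) * Complex.I) := Real.probChar_apply _
  have hχ : Measurable fun v => (χ v : ℂ) := by
    simp_rw [hχ_apply]
    fun_prop
  have hχσ : Integrable (fun x : X => (χ (pointVector x) : ℂ)) σ :=
    .of_bound (hχ.comp measurable_pointVector).aestronglyMeasurable 1
      (.of_forall fun x => (Circle.norm_coe _).le)
  simp_rw [← hχ_apply]
  rw [integral_addChar_compoundPoisson _ hχ, integral_map measurable_pointVector.aemeasurable
    hχ.aestronglyMeasurable, integral_smul_measure, integral_sub hχσ (integrable_const 1)]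
  have hσ : ((σ Set.univ).toReal : ℂ) ≠ 0 := by
    simp [ENNReal.toReal_eq_zero_iff, NeZero.ne σ]
  simp only [ENNReal.toReal_inv, ENNReal.coe_toNNReal_eq_toReal, integral_const, Measure.real,
    mul_one, Complex.real_smul, Complex.ofReal_inv]
  field_simp

theorem toNNReal_mul_meanSqIncrement (σ : Measure X) [IsFiniteMeasure σ] [NeZero σ]
    {G : ({B : Set X // MeasurableSet B} → ℝ) → ℝ} (hG : Measurable G)
    (v : {B : Set X // MeasurableSet B} → ℝ) :
    (σ Set.univ).toNNReal * meanSqIncrement (((σ Set.univ)⁻¹ • σ).map pointVector) G v =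
      ∫⁻ x, ‖G (v + pointVector x) - G v‖ₑ ^ 2 ∂σ := by
  rw [meanSqIncrement, lintegral_map (by fun_prop) measurable_pointVector,
    lintegral_smul_measure, smul_eq_mul, ENNReal.coe_toNNReal (measure_ne_top σ _), ← mul_assoc,
    ENNReal.mul_inv_cancel (Measure.measure_univ_ne_zero.2 (NeZero.ne σ)) (measure_ne_top σ _),
    one_mul]

end PointVector

section CountVector

variable {X : Type*} [TopologicalSpace X] [MeasurableSpace X]

/-- The family of the numbers of points of `ω` in the measurable sets. Values in the vector space
`{B // MeasurableSet B} → ℝ` turn the adjunction of a point into a translation; the price is that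
the junk value `(⊤ : ℕ∞).toNat = 0` loses information when `ω` is infinite. -/
noncomputable def countVector (ω : Configuration X) : {B : Set X // MeasurableSet B} → ℝ :=
  fun B => (ω.number B).toNat

theorem measurable_countVector :
    Measurable (countVector : Configuration X → {B : Set X // MeasurableSet B} → ℝ) :=
  measurable_pi_lambda _ fun B => measurable_from_nat.comp (measurable_toNat_number B.2)

theorem countVector_addPoint {ω : Configuration X} (hω : ω.number Set.univ ≠ ⊤) {x : X}
    (hx : x ∉ ω.carrier) : (ω.addPoint x).countVector = ω.countVector + pointVector x := by
  ext B
  simp only [countVector, pointVector, Pi.add_apply, toNat_number_addPoint hω hx]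
  by_cases hB : x ∈ (B : Set X) <;> simp [hB]

theorem exists_measurable_comp_countVector {F : Configuration X → ℝ} (hF : Measurable F) :
    ∃ G : ({B : Set X // MeasurableSet B} → ℝ) → ℝ, Measurable G ∧
      ∀ ω : Configuration X, ω.number Set.univ ≠ ⊤ → F ω = G ω.countVector := by
  let counts (ω : Configuration X) (B : {B : Set X // MeasurableSet B}) : ℕ∞ := ω.number B
  have hcomap : (instMeasurableSpace : MeasurableSpace (Configuration X)) ≤
      MeasurableSpace.pi.comap counts :=
    iSup₂_le fun B hB => measurable_iff_comap_le.1 <|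
      (measurable_pi_apply (⟨B, hB⟩ : {B : Set X // MeasurableSet B})).comp
        (comap_measurable counts)
  obtain ⟨G, hG, rfl⟩ := (hF.mono hcomap le_rfl).exists_eq_measurable_comp
  refine ⟨fun v => G fun B => (⌊v B⌋₊ : ℕ∞), by fun_prop, fun ω hω => ?_⟩
  simp [counts, countVector, ENat.natCast_toNat (number_ne_top hω _)]

theorem IsPoissonMeasure.map_countVector {σ : Measure X} [IsFiniteMeasure σ] [NeZero σ]
    {π : Measure (Configuration X)} (hπ : IsPoissonMeasure σ π) :
    π.map countVector =
      compoundPoisson (σ Set.univ).toNNReal (((σ Set.univ)⁻¹ • σ).map pointVector) := by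
  have := hπ.isProbabilityMeasure
  have := Measure.isProbabilityMeasure_map (μ := π) measurable_countVector.aemeasurable
  have := Measure.isProbabilityMeasure_map (μ := (σ Set.univ)⁻¹ • σ)
    measurable_pointVector.aemeasurable
  refine ext_of_forall_integral_exp_finset_sum fun s c => ?_
  obtain ⟨f, hf⟩ := exists_simpleFunc_eq_sum_mul_pointVector s c
  rw [integral_exp_sum_compoundPoisson,
    integral_map measurable_countVector.aemeasurable
      (Measurable.aestronglyMeasurable (by fun_prop))]
  simp_rw [← hf]
  rw [← hπ.integral_exp_simpleFunc]
  refine integral_congr_ae (hπ.ae_number_univ_ne_top.mono fun ω hω => ?_)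
  have := isFiniteMeasure_toMeasure hω
  simp only [hf, integral_sum_mul_pointVector, countVector, toMeasure_real ω (Subtype.prop _)]

end CountVector

section Poincare

variable {X : Type*} [TopologicalSpace X] [MeasurableSpace X] {σ : Measure X}

theorem ae_enorm_addPoint_sub_le_gradNorm (σ : Measure X) [NullSingletonClass σ]
    (F : Configuration X → ℝ) (ω : Configuration X) :
    ∀ᵐ x ∂σ, ‖F (ω.addPoint x) - F ω‖ₑ ≤ gradNorm σ ∞ F ω := by
  have hgrad : ∀ᵐ x ∂(2⁻¹ : ℝ≥0∞) • (σ + ω.toMeasure), ‖grad F ω x‖ₑ ≤ gradNorm σ ∞ F ω :=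
    ae_le_eLpNormEssSup
  rw [Measure.ae_ennreal_smul_measure_iff (by simp), ae_add_measure_iff] at hgrad
  have hnotMem : ∀ᵐ x ∂σ, x ∉ ω.carrier :=
    measure_eq_zero_iff_ae_notMem.1 (ω.countable.measure_zero σ)
  filter_upwards [hgrad.1, hnotMem] with x hx hxω
  rwa [grad, if_neg hxω, enorm_sub_rev] at hx

variable [IsFiniteMeasure σ] {π : Measure (Configuration X)} {F : Configuration X → ℝ}

theorem IsPoissonMeasure.evariance_le_lintegral_lintegral_enorm_addPoint_sub_sq [NeZero σ]
    [NullSingletonClass σ] (hπ : IsPoissonMeasure σ π) (hF : Measurable F)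
    (hF1 : Integrable F π) :
    evariance F π ≤ ∫⁻ ω, ∫⁻ x, ‖F (ω.addPoint x) - F ω‖ₑ ^ 2 ∂σ ∂π := by
  have := Measure.isProbabilityMeasure_map (μ := (σ Set.univ)⁻¹ • σ)
    measurable_pointVector.aemeasurable
  obtain ⟨G, hG, hFG⟩ := exists_measurable_comp_countVector hF
  have hae : F =ᵐ[π] G ∘ countVector := hπ.ae_number_univ_ne_top.mono hFG
  have hG1 : Integrable G (π.map countVector) :=
    (integrable_map_measure hG.aestronglyMeasurable measurable_countVector.aemeasurable).2
      (hF1.congr hae)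
  rw [evariance_congr hae, ← evariance_map hG measurable_countVector]
  rw [hπ.map_countVector] at hG1 ⊢
  refine (evariance_compoundPoisson_le _ hG hG1).trans ?_
  rw [← lintegral_const_mul _ (measurable_meanSqIncrement hG), ← hπ.map_countVector]
  simp_rw [toNNReal_mul_meanSqIncrement σ hG]
  refine (lintegral_map_le _ _).trans (lintegral_mono_ae ?_)
  filter_upwards [hπ.ae_number_univ_ne_top] with ω hω
  refine lintegral_mono_ae ?_
  filter_upwards [measure_eq_zero_iff_ae_notMem.1 (ω.countable.measure_zero σ)] with x hx
  have hωx : (ω.addPoint x).number Set.univ ≠ ⊤ := by simpa [number_addPoint hx] using hω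
  rw [hFG _ hω, hFG _ hωx, countVector_addPoint hω hx]

theorem IsPoissonMeasure.evariance_le_mul_lintegral_gradNorm_sq [NeZero σ]
    [NullSingletonClass σ] (hπ : IsPoissonMeasure σ π) (hF : Measurable F)
    (hF1 : Integrable F π) :
    evariance F π ≤ σ Set.univ * ∫⁻ ω, gradNorm σ ∞ F ω ^ 2 ∂π := by
  refine (hπ.evariance_le_lintegral_lintegral_enorm_addPoint_sub_sq hF hF1).trans ?_
  rw [← lintegral_const_mul' _ _ (measure_ne_top σ _)]
  gcongr with ω
  calc ∫⁻ x, ‖F (ω.addPoint x) - F ω‖ₑ ^ 2 ∂σ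
      ≤ ∫⁻ _, gradNorm σ ∞ F ω ^ 2 ∂σ :=
        lintegral_mono_ae <| (ae_enorm_addPoint_sub_le_gradNorm σ F ω).mono fun x hx =>
          pow_le_pow_left' hx 2
    _ = σ Set.univ * gradNorm σ ∞ F ω ^ 2 := by rw [lintegral_const, mul_comm]

end Poincare

section Gradient

variable {X : Type*} [TopologicalSpace X] {F G : Configuration X → ℝ} {ω : Configuration X}

theorem exists_grad_eq_sub (ω : Configuration X) (x : X) :
    ∃ ω', ∀ F : Configuration X → ℝ, grad F ω x = F ω - F ω' := by
  by_cases hx : x ∈ ω.carrier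
  · exact ⟨ω.removePoint x, fun F => if_pos hx⟩
  · exact ⟨ω.addPoint x, fun F => if_neg hx⟩

variable [MeasurableSpace X]

theorem gradNorm_mono (σ : Measure X) (p : ℝ≥0∞) (ω : Configuration X)
    (h : ∀ ω ω', ‖F ω - F ω'‖ ≤ ‖G ω - G ω'‖) : gradNorm σ p F ω ≤ gradNorm σ p G ω := by
  refine eLpNorm_mono fun x => ?_
  obtain ⟨ω', hω'⟩ := exists_grad_eq_sub ω x
  simpa only [hω'] using h ω ω'

theorem gradNorm_top_toNat_number_univ_le_one (σ : Measure X) (hω : ω.number Set.univ ≠ ⊤) :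
    gradNorm σ ∞ (fun ω => ((ω.number Set.univ).toNat : ℝ)) ω ≤ 1 := by
  rw [gradNorm, eLpNorm_exponent_top, ← ENNReal.ofReal_one]
  refine eLpNormEssSup_le_of_ae_bound (.of_forall fun x => ?_)
  by_cases hx : x ∈ ω.carrier
  · simp [grad, hx, ← toNat_number_removePoint_add_one hω hx]
  · simp [grad, hx, toNat_number_addPoint hω hx]

theorem gradNorm_top_indicator_lt_le {σ : Measure X} {D : Configuration X → ℕ}
    (hD : gradNorm σ ∞ (fun ω => (D ω : ℝ)) ω ≤ 1) (j : ℕ) :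
    gradNorm σ ∞ ({ω | j < D ω}.indicator fun _ => 1) ω ≤
      {ω | D ω = j}.indicator 1 ω + {ω | D ω = j + 1}.indicator 1 ω := by
  refine essSup_le_of_ae_le _ ?_
  filter_upwards [ae_le_eLpNormEssSup (f := grad (fun ω => (D ω : ℝ)) ω)
    (μ := (2⁻¹ : ℝ≥0∞) • (σ + ω.toMeasure))] with x hx
  obtain ⟨ω', hω'⟩ := exists_grad_eq_sub ω x
  have hdist : |(D ω : ℝ) - D ω'| ≤ 1 := by
    simpa [hω', Real.enorm_eq_ofReal_abs] using hx.trans hD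
  have hadjacent : D ω ≤ D ω' + 1 ∧ D ω' ≤ D ω + 1 := by
    rw [abs_sub_le_iff, sub_le_iff_le_add', sub_le_iff_le_add'] at hdist
    exact_mod_cast hdist
  rw [hω']
  by_cases hj : j < D ω <;> by_cases hj' : j < D ω'
  · simp [hj, hj']
  · have : D ω = j + 1 := by lia
    simp [hj', this]
  · have : D ω = j := by lia
    simp [hj', this]
  · simp [hj, hj']

end Gradient

section PoincareConstant

variable {X : Type*} [TopologicalSpace X] [MeasurableSpace X] {σ : Measure X}
  {π : Measure (Configuration X)}

theorem IsPoissonMeasure.memLp_toNat_number_univ (hπ : IsPoissonMeasure σ π) :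
    MemLp (fun ω : Configuration X => ((ω.number Set.univ).toNat : ℝ)) 2 π := by
  have h := memLp_natCast_poissonMeasure (σ Set.univ).toNNReal
  rw [← hπ.map_toNat_number_univ] at h
  exact h.comp_measurePreserving ⟨measurable_toNat_number .univ, rfl⟩

theorem IsPoissonMeasure.lintegral_gradNorm_toNat_number_univ_sq_le (hπ : IsPoissonMeasure σ π) :
    ∫⁻ ω, gradNorm σ ∞ (fun ω => ((ω.number Set.univ).toNat : ℝ)) ω ^ 2 ∂π ≤ 1 := by
  have := hπ.isProbabilityMeasure
  calc ∫⁻ ω, gradNorm σ ∞ (fun ω => ((ω.number Set.univ).toNat : ℝ)) ω ^ 2 ∂π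
      ≤ ∫⁻ _, 1 ∂π := lintegral_mono_ae <| hπ.ae_number_univ_ne_top.mono fun ω hω =>
        pow_le_one' (gradNorm_top_toNat_number_univ_le_one σ hω) 2
    _ = 1 := by simp

variable [IsFiniteMeasure σ]

theorem IsPoissonMeasure.evariance_toNat_number_univ (hπ : IsPoissonMeasure σ π) :
    evariance (fun ω : Configuration X => ((ω.number Set.univ).toNat : ℝ)) π = σ Set.univ := by
  have h := evariance_natCast_poissonMeasure (σ Set.univ).toNNReal
  rw [← hπ.map_toNat_number_univ, evariance_map .of_discrete (measurable_toNat_number .univ),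
    ENNReal.coe_toNNReal (measure_ne_top σ _)] at h
  exact h

theorem IsPoissonMeasure.poincareConstant_top_eq [NeZero σ] [NullSingletonClass σ]
    (hπ : IsPoissonMeasure σ π) : poincareConstant σ π ∞ = 1 / σ Set.univ := by
  have := hπ.isProbabilityMeasure
  have hσ : σ Set.univ ≠ 0 := Measure.measure_univ_ne_zero.2 (NeZero.ne σ)
  apply le_antisymm
  · have hN : Measurable fun ω : Configuration X => ((ω.number Set.univ).toNat : ℝ) :=
      measurable_from_nat.comp (measurable_toNat_number .univ)
    refine iInf₂_le_of_le _ hN (iInf₂_le_of_le hπ.memLp_toNat_number_univ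
      (by rwa [hπ.evariance_toNat_number_univ]) ?_)
    rw [hπ.evariance_toNat_number_univ]
    exact ENNReal.div_le_div_right hπ.lintegral_gradNorm_toNat_number_univ_sq_le _
  · refine le_iInf₂ fun F hF => le_iInf₂ fun hF2 hF0 => ?_
    rw [ENNReal.le_div_iff_mul_le (.inl hF0) (.inl (evariance_lt_top hF2).ne), mul_comm,
      mul_one_div]
    exact ENNReal.div_le_of_le_mul'
      (hπ.evariance_le_mul_lintegral_gradNorm_sq hF (hF2.integrable one_le_two))

end PoincareConstant

section Isoperimetry

variable {X : Type*} [TopologicalSpace X] [MeasurableSpace X] {σ : Measure X}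
  {π : Measure (Configuration X)}

theorem isoperimetricConstant_mul_measure_le {p : ℝ≥0∞} {A : Set (Configuration X)}
    (hA : MeasurableSet A) (hA' : π A < 1 / 2) :
    isoperimetricConstant σ π p * π A ≤
      ∫⁻ ω, gradNorm σ p (A.indicator fun _ => 1) ω ∂π := by
  rcases eq_or_ne (π A) 0 with h0 | h0
  · simp [h0]
  · rw [← ENNReal.le_div_iff_mul_le (.inl h0) (.inl hA'.ne_top)]
    exact iInf₂_le_of_le A hA (iInf₂_le (pos_iff_ne_zero.2 h0) hA')

theorem isoperimetricConstant_top_mul_lintegral_sq_le {D : Configuration X → ℕ}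
    (hD : Measurable D) (hgrad : ∀ᵐ ω ∂π, gradNorm σ ∞ (fun ω => (D ω : ℝ)) ω ≤ 1)
    (hhalf : π {ω | 0 < D ω} < 1 / 2) :
    isoperimetricConstant σ π ∞ * ∫⁻ ω, (D ω : ℝ≥0∞) ^ 2 ∂π ≤
      4 * ∫⁻ ω, (D ω : ℝ≥0∞) ∂π + π {ω | D ω = 0} := by
  have hlevel (j : ℕ) : MeasurableSet {ω | D ω = j} := hD (measurableSet_singleton j)
  have h := mul_lintegral_sq_le_of_measure_Ioi_le (ν := π.map D)
    (C := isoperimetricConstant σ π ∞) fun j => ?_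
  · rwa [lintegral_map .of_discrete hD, lintegral_map .of_discrete hD,
      Measure.map_apply hD .of_discrete] at h
  · simp_rw [Measure.map_apply hD (MeasurableSet.of_discrete (α := ℕ))]
    calc isoperimetricConstant σ π ∞ * π {ω | j < D ω}
        ≤ ∫⁻ ω, gradNorm σ ∞ ({ω | j < D ω}.indicator fun _ => 1) ω ∂π :=
          isoperimetricConstant_mul_measure_le (hD .of_discrete)
            ((measure_mono fun ω => Nat.zero_lt_of_lt).trans_lt hhalf)
      _ ≤ ∫⁻ ω, {ω | D ω = j}.indicator 1 ω + {ω | D ω = j + 1}.indicator 1 ω ∂π :=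
          lintegral_mono_ae (hgrad.mono fun ω hω => gradNorm_top_indicator_lt_le hω j)
      _ = π {ω | D ω = j} + π {ω | D ω = j + 1} := by
          rw [lintegral_add_left (measurable_one.indicator (hlevel j)),
            lintegral_indicator_one (hlevel j), lintegral_indicator_one (hlevel (j + 1))]

theorem IsPoissonMeasure.measure_le_toNat_number_univ_ne_zero [IsFiniteMeasure σ] [NeZero σ]
    (hπ : IsPoissonMeasure σ π) (l : ℕ) :
    π {ω | l ≤ (ω.number Set.univ).toNat} ≠ 0 := by
  have hσ : 0 < (σ Set.univ).toNNReal :=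
    ENNReal.toNNReal_pos (Measure.measure_univ_ne_zero.2 (NeZero.ne σ)) (measure_ne_top σ _)
  have h : poissonMeasure (σ Set.univ).toNNReal (Set.Ici l) ≠ 0 := fun h =>
    (poissonMeasure_real_singleton_pos l hσ).ne' <| by
      rw [Measure.real, measure_mono_null (Set.singleton_subset_iff.2 Set.self_mem_Ici) h]
      rfl
  rwa [← hπ.map_toNat_number_univ,
    Measure.map_apply (measurable_toNat_number .univ) .of_discrete] at h

variable [IsProbabilityMeasure π] {N : Configuration X → ℕ} {m : ℕ}

theorem isoperimetricConstant_top_mul_lintegral_lower_deviation_sq_le (hN : Measurable N)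
    (hgrad : ∀ᵐ ω ∂π, gradNorm σ ∞ (fun ω => (N ω : ℝ)) ω ≤ 1)
    (hlower : π {ω | N ω < m} < 1 / 2) :
    isoperimetricConstant σ π ∞ * ∫⁻ ω, ((m - N ω : ℕ) : ℝ≥0∞) ^ 2 ∂π ≤
      4 * ∫⁻ ω, ((m - N ω : ℕ) : ℝ≥0∞) ∂π + 1 := by
  refine (isoperimetricConstant_top_mul_lintegral_sq_le (measurable_from_nat.comp hN)
    (hgrad.mono fun ω => (gradNorm_mono σ ∞ ω fun ω ω' => ?_).trans)
    (by simpa using hlower)).trans (add_le_add_right prob_le_one _)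
  have hlipschitz : |((m - N ω : ℕ) : ℤ) - (m - N ω' : ℕ)| ≤ |(N ω : ℤ) - N ω'| := by
    simp only [Int.abs_eq_natAbs]
    lia
  simp only [Function.comp_apply, Real.norm_eq_abs]
  exact_mod_cast hlipschitz

-- The superlevel set `{m < N}` may have measure exactly `1 / 2`; truncation at height `l` makes the
-- inequality strict.
theorem isoperimetricConstant_top_mul_lintegral_truncated_deviation_sq_le (hN : Measurable N)
    (hgrad : ∀ᵐ ω ∂π, gradNorm σ ∞ (fun ω => (N ω : ℝ)) ω ≤ 1)
    (hupper : π {ω | m < N ω} ≤ 1 / 2) (hunbounded : ∀ l, π {ω | l ≤ N ω} ≠ 0) (l : ℕ) :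
    isoperimetricConstant σ π ∞ * ∫⁻ ω, ((min (N ω - m) (l - N ω) : ℕ) : ℝ≥0∞) ^ 2 ∂π ≤
      4 * ∫⁻ ω, ((N ω - m : ℕ) : ℝ≥0∞) ∂π + 1 := by
  set D : Configuration X → ℕ := fun ω => min (N ω - m) (l - N ω) with hD
  have hDmeas : Measurable D := measurable_from_nat.comp (g := fun n => min (n - m) (l - n)) hN
  have hDgrad : ∀ᵐ ω ∂π, gradNorm σ ∞ (fun ω => (D ω : ℝ)) ω ≤ 1 := by
    refine hgrad.mono fun ω => (gradNorm_mono σ ∞ ω fun ω ω' => ?_).trans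
    have hlipschitz : |(D ω : ℤ) - D ω'| ≤ |(N ω : ℤ) - N ω'| := by
      simp only [Int.abs_eq_natAbs, hD]
      lia
    simp only [Real.norm_eq_abs]
    exact_mod_cast hlipschitz
  have hhalf : π {ω | 0 < D ω} < 1 / 2 := by
    have hdisjoint : Disjoint {ω | 0 < D ω} {ω | max l (m + 1) ≤ N ω} :=
      Set.disjoint_left.2 fun ω hω hω' => by
        simp only [hD, Set.mem_ofPred_eq] at hω hω'
        lia
    have hsubset : {ω | 0 < D ω} ∪ {ω | max l (m + 1) ≤ N ω} ⊆ {ω | m < N ω} := by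
      rintro ω (hω | hω) <;> simp only [hD, Set.mem_ofPred_eq] at hω ⊢ <;> lia
    calc π {ω | 0 < D ω}
        < π {ω | 0 < D ω} + π {ω | max l (m + 1) ≤ N ω} :=
          ENNReal.lt_add_right (measure_ne_top _ _) (hunbounded _)
      _ = π ({ω | 0 < D ω} ∪ {ω | max l (m + 1) ≤ N ω}) :=
          (measure_union hdisjoint (hN .of_discrete)).symm
      _ ≤ 1 / 2 := (measure_mono hsubset).trans hupper
  refine (isoperimetricConstant_top_mul_lintegral_sq_le hDmeas hDgrad hhalf).trans
    (add_le_add ?_ prob_le_one)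
  gcongr with ω
  exact min_le_left _ _

theorem isoperimetricConstant_top_mul_lintegral_upper_deviation_sq_le (hN : Measurable N)
    (hgrad : ∀ᵐ ω ∂π, gradNorm σ ∞ (fun ω => (N ω : ℝ)) ω ≤ 1)
    (hupper : π {ω | m < N ω} ≤ 1 / 2) (hunbounded : ∀ l, π {ω | l ≤ N ω} ≠ 0) :
    isoperimetricConstant σ π ∞ * ∫⁻ ω, ((N ω - m : ℕ) : ℝ≥0∞) ^ 2 ∂π ≤
      4 * ∫⁻ ω, ((N ω - m : ℕ) : ℝ≥0∞) ∂π + 1 := by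
  have hsup (ω : Configuration X) : ((N ω - m : ℕ) : ℝ≥0∞) ^ 2 =
      ⨆ l, ((min (N ω - m) (l - N ω) : ℕ) : ℝ≥0∞) ^ 2 := by
    refine le_antisymm (le_iSup_of_le (2 * N ω) ?_) (iSup_le fun l => ?_)
    · gcongr
      exact le_min le_rfl (by lia)
    · gcongr
      exact min_le_left _ _
  have hmeas (l : ℕ) :
      Measurable fun ω => ((min (N ω - m) (l - N ω) : ℕ) : ℝ≥0∞) ^ 2 :=
    measurable_from_nat.comp (g := fun n => ((min (n - m) (l - n) : ℕ) : ℝ≥0∞) ^ 2) hN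
  have hmono :
      Monotone fun l ω => ((min (N ω - m) (l - N ω) : ℕ) : ℝ≥0∞) ^ 2 := fun k l hkl ω => by
    dsimp only
    gcongr
  simp_rw [hsup]
  rw [lintegral_iSup hmeas hmono, ENNReal.mul_iSup]
  exact iSup_le <| isoperimetricConstant_top_mul_lintegral_truncated_deviation_sq_le hN hgrad
    hupper hunbounded

theorem isoperimetricConstant_top_mul_lintegral_deviation_sq_le (hN : Measurable N)
    (hgrad : ∀ᵐ ω ∂π, gradNorm σ ∞ (fun ω => (N ω : ℝ)) ω ≤ 1)
    (hlower : π {ω | N ω < m} < 1 / 2) (hupper : π {ω | m < N ω} ≤ 1 / 2)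
    (hunbounded : ∀ l, π {ω | l ≤ N ω} ≠ 0) :
    isoperimetricConstant σ π ∞ * ∫⁻ ω, ‖(N ω : ℝ) - m‖ₑ ^ 2 ∂π ≤
      4 * ∫⁻ ω, ‖(N ω : ℝ) - m‖ₑ ∂π + 2 := by
  simp_rw [enorm_natCast_sub_natCast_sq, enorm_natCast_sub_natCast]
  have hmeas : Measurable fun ω => ((N ω - m : ℕ) : ℝ≥0∞) :=
    measurable_from_nat.comp (g := fun n => ((n - m : ℕ) : ℝ≥0∞)) hN
  rw [lintegral_add_left (hmeas.pow_const 2), lintegral_add_left hmeas, mul_add, mul_add]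
  refine (add_le_add (isoperimetricConstant_top_mul_lintegral_upper_deviation_sq_le hN hgrad hupper
    hunbounded) (isoperimetricConstant_top_mul_lintegral_lower_deviation_sq_le hN hgrad
    hlower)).trans_eq ?_
  rw [add_add_add_comm, one_add_one_eq_two]

theorem sq_rpow_isoperimetricConstant_top_le_one_div_evariance
    (hN : MemLp (fun ω => (N ω : ℝ)) 2 π) (hN' : Measurable N)
    (hgrad : ∀ᵐ ω ∂π, gradNorm σ ∞ (fun ω => (N ω : ℝ)) ω ≤ 1)
    (hunbounded : ∀ l, π {ω | l ≤ N ω} ≠ 0) :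
    ((isoperimetricConstant σ π ∞ + 1) ^ (1 / 2 : ℝ) - 1) ^ 2 / 4 ≤
      1 / evariance (fun ω => (N ω : ℝ)) π := by
  have := Measure.isProbabilityMeasure_map (μ := π) hN'.aemeasurable
  obtain ⟨m, hlower, hupper⟩ := exists_nat_median (π.map N)
  rw [Measure.map_apply hN' .of_discrete] at hlower hupper
  have hdev : MemLp (fun ω => (N ω : ℝ) - m) 2 π := hN.sub (memLp_const _)
  set s := eLpNorm (fun ω => (N ω : ℝ) - m) 2 π
  have hsq : s ^ 2 = ∫⁻ ω, ‖(N ω : ℝ) - m‖ₑ ^ 2 ∂π := by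
    simpa using eLpNorm_nnreal_pow_eq_lintegral (f := fun ω => (N ω : ℝ) - m) (μ := π)
      (two_ne_zero : (2 : NNReal) ≠ 0)
  have hmean : ∫⁻ ω, ‖(N ω : ℝ) - m‖ₑ ∂π ≤ s := by
    rw [← eLpNorm_one_eq_lintegral_enorm]
    exact eLpNorm_le_eLpNorm_of_exponent_le one_le_two hdev.aestronglyMeasurable
  calc ((isoperimetricConstant σ π ∞ + 1) ^ (1 / 2 : ℝ) - 1) ^ 2 / 4 ≤ 1 / s ^ 2 := by
        refine sq_rpow_half_sub_one_div_four_le hdev.eLpNorm_ne_top ?_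
        rw [hsq]
        exact (isoperimetricConstant_top_mul_lintegral_deviation_sq_le hN' hgrad hlower hupper
          hunbounded).trans (add_le_add_left (mul_le_mul_right hmean 4) 2)
    _ ≤ 1 / evariance (fun ω => (N ω : ℝ)) π :=
        ENNReal.div_le_div_left (hsq ▸ evariance_le_lintegral_enorm_sub_sq hN m) 1

end Isoperimetry

end Configuration

theorem mainTheorem9_general {X : Type*} [TopologicalSpace X] [MeasurableSpace X]
    (σ : Measure X) [IsFiniteMeasure σ] [NullSingletonClass σ] (hσ : σ ≠ 0)
    (π : Measure (Configuration X)) (hπ : Configuration.IsPoissonMeasure σ π) :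
    Configuration.poincareConstant σ π ∞ = 1 / σ Set.univ ∧
      ((Configuration.isoperimetricConstant σ π ∞ + 1) ^ (1 / 2 : ℝ) - 1) ^ 2 / 4 ≤
        Configuration.poincareConstant σ π ∞ := by
  have : NeZero σ := ⟨hσ⟩
  have := hπ.isProbabilityMeasure
  refine ⟨hπ.poincareConstant_top_eq, ?_⟩
  rw [hπ.poincareConstant_top_eq, ← hπ.evariance_toNat_number_univ]
  exact Configuration.sq_rpow_isoperimetricConstant_top_le_one_div_evariance
    hπ.memLp_toNat_number_univ (Configuration.measurable_toNat_number .univ)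
    (hπ.ae_number_univ_ne_top.mono fun _ =>
      Configuration.gradNorm_top_toNat_number_univ_le_one σ)
    hπ.measure_le_toNat_number_univ_ne_zero

theorem mainTheorem9 {X : Type*} [MetricSpace X] [MeasurableSpace X] [BorelSpace X]
    (σ : Measure X) [IsFiniteMeasure σ] [NullSingletonClass σ] (hσ : σ ≠ 0)
    (π : Measure (Configuration X)) (hπ : Configuration.IsPoissonMeasure σ π) :
    Configuration.poincareConstant σ π ∞ = 1 / σ Set.univ ∧
      ((Configuration.isoperimetricConstant σ π ∞ + 1) ^ (1 / 2 : ℝ) - 1) ^ 2 / 4 ≤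
        Configuration.poincareConstant σ π ∞ :=
  mainTheorem9_general σ hσ π hπ
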